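/- Let $d\ge 1$ and let $f:\mathbb R^d\to\mathbb R$ be convex and three times continuously differentiable, and suppose that for $r=1,2,3$ it is $r$th-order smooth with a constant $L_r>0$: for all $x,y$, $\max_{\|s\|\le 1}|(\nabla^r f(x)-\nabla^r f(y))[s]^r|\le L_r\|x-y\|$, where $\nabla^r f(x)[s]^r=\sum_{i_1,\dots,i_r}\frac{\partial^r f(x)}{\partial x_{i_1}\cdots\partial x_{i_r}}s_{i_1}\cdots s_{i_r}$. Assume that the set of minimizers $\mathcal X^*=\arg\min f$ is non-empty. Let $\varepsilon>0$, let $\lambda>0$ be given by $$\lambda^2=\min\Big\{\frac{\sqrt2\,L_1}{d^{3/2}L_3},\ \frac{12\sqrt{L_1\varepsilon}}{L_3(d+10)^2},\ \frac{3\varepsilon}{4L_3(d+4)^2},\ \frac{3L_1\varepsilon}{L_2^2(d+6)^3}\Big\},$$ put $F(x)=f(x)+\frac{\lambda^2}{2}\operatorname{tr}\nabla^2 f(x)$, let $x_F^*$ be a minimizer of $F$ (assumed to exist), and let $x_0\in\mathbb R^d$. Consider Gaussian two-point zeroth-order descent for $T\ge1$ iterations with $\eta=1/(8(d+6)L_1)$: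 for $t=0,\dots,T-1$, $$x_{t+1}=x_t-\eta\,\frac{f(x_t+\lambda u_t)-f(x_t-\lambda u_t)}{2\lambda}\,u_t,$$ with $u_0,\dots,u_{T-1}$ independent standard Gaussian vectors in $\mathbb R^d$; the output is $x_\tau$, where $\tau$ is uniform on $\{0,\dots,T-1\}$ and independent of $(u_t)_t$. (i) If $$T\ \ge\ B:=\frac{64(d+6)L_1\|x_0-x_F^*\|^2}{\varepsilon}\max\Big\{\frac{d^{3/2}L_3}{\sqrt2\,L_1},\ \frac{L_3(d+10)^2}{12\sqrt{L_1\varepsilon}},\ \frac{4L_3(d+4)^2}{3\varepsilon},\ \frac{L_2^2(d+6)^3}{3L_1\varepsilon}\Big\},$$ then $f(x_\tau)$ and $\operatorname{tr}\nabla^2f(x_\tau)$ are integrable and $$\mathbb E\big[f(x_\tau)-\min f\big]\le\frac{3L_1^2\varepsilon}{2L_2^2(d+6)^2}\Big(1+\frac{\varepsilon}{L_1(d+6)}\Big),\qquad \mathbb E\Big[\operatorname{tr}\nabla^2f(x_\tau)-\inf_{x\in\mathcal X^*}\operatorname{tr}\nabla^2f(x)\Big]\le\varepsilon .$$ (ii)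 Consequently, in expectation, $(O(\varepsilon/d^2),\varepsilon)$-approximate flat minima are obtained with $T=O(d^4/\varepsilon^2)$ and $\lambda=O(\varepsilon^{1/2}/d^{3/2})$. Precisely: for every $\varepsilon_0>0$ there is a constant $C>0$ that depends only on $L_1,L_2,L_3,\varepsilon_0$ such that, for all $d$, $f$, $x_0$, $x_F^*$ as above and all $0<\varepsilon\le\varepsilon_0$, one has $\lambda\le C\varepsilon^{1/2}/d^{3/2}$, and there is an integer $T\ge1$ with $B\le T\le C(1+\|x_0-x_F^*\|^2)\,d^4/\varepsilon^2$ for which $\mathbb E[f(x_\tau)-\min f]\le C\varepsilon/d^2$ and $\mathbb E[\operatorname{tr}\nabla^2f(x_\tau)-\inf_{x\in\mathcal X^*}\operatorname{tr}\nabla^2f(x)]\le\varepsilon$ (with both expectations finite). -/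

import Mathlib

open MeasureTheory ProbabilityTheory

noncomputable section

namespace ZOFlat

/-- `ℝ^d` with its Euclidean norm. -/
abbrev E (d : ℕ) : Type := EuclideanSpace ℝ (Fin d)

/-- `q` is `r`th-order smooth with constant `L`: it is `r` times differentiable and
`max_{‖s‖ ≤ 1} |(∇^r q(x) - ∇^r q(y))[s]^r| ≤ L ‖x - y‖` for all `x, y`.
Here `∇^r q(x)[s]^r` is the `r`th derivative applied to `(s, …, s)`, that is
`∑ (∂^r q(x) / ∂x_{i₁} ⋯ ∂x_{i_r}) s_{i₁} ⋯ s_{i_r}`. -/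
def OrderSmooth {d : ℕ} (r : ℕ) (L : ℝ) (q : E d → ℝ) : Prop :=
  (∀ m < r, Differentiable ℝ (iteratedFDeriv ℝ m q)) ∧
    ∀ x y s : E d, ‖s‖ ≤ 1 →
      |iteratedFDeriv ℝ r q x (fun _ => s) - iteratedFDeriv ℝ r q y (fun _ => s)| ≤ L * ‖x - y‖

/-- `f` is three times continuously differentiable, `L₁`-smooth, second-order smooth with `L₂`
and third-order smooth with `L₃`. -/
structure Smoothness {d : ℕ} (f : E d → ℝ) (L₁ L₂ L₃ : ℝ) : Prop where
  contDiff : ContDiff ℝ 3 f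
  first : OrderSmooth 1 L₁ f
  second : OrderSmooth 2 L₂ f
  third : OrderSmooth 3 L₃ f

/-- The Hessian matrix `(∂²f(x) / ∂x_i ∂x_j)_{i,j}`. -/
def hessian {d : ℕ} (f : E d → ℝ) (x : E d) : Matrix (Fin d) (Fin d) ℝ :=
  Matrix.of fun i j =>
    iteratedFDeriv ℝ 2 f x ![EuclideanSpace.single i 1, EuclideanSpace.single j 1]

/-- The trace of the Hessian. -/
def trHess {d : ℕ} (f : E d → ℝ) (x : E d) : ℝ := (hessian f x).trace

/-- The set `X* = argmin f` of global minimizers. -/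
def minimizers {d : ℕ} (f : E d → ℝ) : Set (E d) := {x | ∀ y, f x ≤ f y}

/-- The smallest trace of the Hessian over `X*` (an infimum, so it need not be attained). -/
def minTrHess {d : ℕ} (f : E d → ℝ) : ℝ := ⨅ x : minimizers f, trHess f x

/-- The regularized loss `F(x) = f(x) + (λ²/2) tr ∇²f(x)`. -/
def regLoss {d : ℕ} (f : E d → ℝ) (lam : ℝ) (x : E d) : ℝ :=
  f x + lam ^ 2 / 2 * trHess f x

/-- The two-point estimator `g_λ(x, u) = (f(x + λu) - f(x - λu)) / (2λ) · u`. -/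
def twoPoint {d : ℕ} (f : E d → ℝ) (lam : ℝ) (x u : E d) : E d :=
  ((f (x + lam • u) - f (x - lam • u)) / (2 * lam)) • u

/-- A run of zeroth-order optimization with the two-point estimator, for `T` iterations with
stepsize `η` and smoothing parameter `lam`, started at `x₀`: the directions `u 0, …, u (T-1)` are
independent standard Gaussian vectors, `x` are the iterates, and the output index `τ` is uniform
on `{0, …, T-1}` and independent of the directions. The output of the run is `x_τ`. -/
structure IsRun {d : ℕ} {Ω : Type*} [MeasurableSpace Ω] (P : Measure Ω) (f : E d → ℝ)
    (η lam : ℝ) (x₀ : E d) (T : ℕ) (u : Fin T → Ω → E d) (x : ℕ → Ω → E d)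
    (τ : Ω → Fin T) : Prop where
  gaussian : ∀ t, HasLaw (u t) (stdGaussian (E d)) P
  indep : iIndepFun u P
  init : ∀ ω, x 0 ω = x₀
  step : ∀ (t : Fin T) (ω : Ω),
    x ((t : ℕ) + 1) ω = x t ω - η • twoPoint f lam (x t ω) (u t ω)
  uniform : HasLaw τ (uniformOn (Set.univ : Set (Fin T))) P
  indep_index : IndepFun τ (fun ω t => u t ω) P

/-- The random point `X` is in expectation an `(ε₁, ε₂)`-approximate flat minimum of `f`
(the two expectations being finite). -/
structure IsApproxFlatMinInExpectation {d : ℕ} {Ω : Type*} [MeasurableSpace Ω] (P : Measure Ω)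
    (f : E d → ℝ) (X : Ω → E d) (ε₁ ε₂ : ℝ) : Prop where
  integrable_value : Integrable (fun ω => f (X ω)) P
  integrable_trace : Integrable (fun ω => trHess f (X ω)) P
  value_le : ∫ ω, (f (X ω) - ⨅ y, f y) ∂P ≤ ε₁
  trace_le : ∫ ω, (trHess f (X ω) - minTrHess f) ∂P ≤ ε₂

/-- The stepsize `η = 1 / (8 (d + 6) L₁)`. -/
def stepsize (d : ℕ) (L₁ : ℝ) : ℝ := 1 / (8 * ((d : ℝ) + 6) * L₁)

/-- The prescribed value of `λ²`. -/
def smoothingSq (d : ℕ) (L₁ L₂ L₃ ε : ℝ) : ℝ :=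
  min (min (√2 * L₁ / ((d : ℝ) ^ (3 / 2 : ℝ) * L₃))
          (12 * √(L₁ * ε) / (L₃ * ((d : ℝ) + 10) ^ 2)))
      (min (3 * ε / (4 * L₃ * ((d : ℝ) + 4) ^ 2))
          (3 * L₁ * ε / (L₂ ^ 2 * ((d : ℝ) + 6) ^ 3)))

/-- The prescribed lower bound on the number of iterations, where `R = ‖x₀ - x_F*‖`. -/
def iterBound (d : ℕ) (L₁ L₂ L₃ ε R : ℝ) : ℝ :=
  64 * ((d : ℝ) + 6) * L₁ * R ^ 2 / ε *
    max (max ((d : ℝ) ^ (3 / 2 : ℝ) * L₃ / (√2 * L₁))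
            (L₃ * ((d : ℝ) + 10) ^ 2 / (12 * √(L₁ * ε))))
        (max (4 * L₃ * ((d : ℝ) + 4) ^ 2 / (3 * ε))
            (L₂ ^ 2 * ((d : ℝ) + 6) ^ 3 / (3 * L₁ * ε)))

end ZOFlat

end

/-! The link between the algorithm and the regularized loss F is the Gaussian smoothing f_λ(x) = 𝔼
f(x + λu). By Stein's identity the mean G(x) of the two-point estimator acts as the gradient of f_λ
(`Smoothness.inner_meanEstimator`), so the method is stochastic gradient descent on f_λ, which
inherits convexity and L₁-smoothness estimates from f. Symmetry of the Gaussian cancels the odd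
Taylor terms, so f_λ and F differ by at most L₃λ⁴d(d+2)/24
(`Smoothness.abs_smoothed_sub_regLoss_le`). Convexity of F is never needed: the minimality of x_F is
used only through this comparison.

The second moment of the estimator is at most 4(d+2)‖G‖² plus a term of order λ⁴
(`Smoothness.integral_norm_twoPoint_sq_le`), and ‖G‖² is bounded by 2L₁ times a gap of f_λ. With η =
1/(8(d+6)L₁) this costs half of the decrease supplied by convexity, which gives the one-step
inequality `integral_norm_step_sq_le`. Telescoping and averaging over τ yield 𝔼F(x_τ) - F(x_F) ≤ ‖x₀
- x_F‖²/(ηT) + O(λ⁴) for fixed d and smoothness constants.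

The trace enters F with weight λ²/2 while the bias is only of order λ⁴, so the choices of λ and T
push the gap below λ²ε/2. Comparing F(x_F) with F(y) for y in X* then bounds the trace, because
f(x_τ) ≥ f(y), and bounds the value, because 0 ≤ tr ∇²f ≤ dL₁
(`IsRun.isApproxFlatMinInExpectation`). -/

namespace ZOFlat

/-! ### Gaussian integration by parts and moments. -/

section

section Gaussian

variable {V : Type*} [NormedAddCommGroup V] [InnerProductSpace ℝ V]

open scoped RealInnerProductSpace

/-- The density of the standard Gaussian measure on a Euclidean space. -/
noncomputable def gaussianDensity (x : V) : ℝ :=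
  ((2 * Real.pi) ^ (Module.finrank ℝ V / 2 : ℝ))⁻¹ * Real.exp (-(1 / 2) * ‖x‖ ^ 2)

lemma gaussianDensity_nonneg (x : V) : 0 ≤ gaussianDensity x := by
  unfold gaussianDensity; positivity

lemma continuous_gaussianDensity : Continuous (gaussianDensity : V → ℝ) := by
  unfold gaussianDensity; fun_prop

lemma hasFDerivAt_gaussianDensity (x : V) :
    HasFDerivAt gaussianDensity ((-gaussianDensity x) • innerSL ℝ x) x := by
  have h1 : HasFDerivAt (fun y : V => ‖y‖ ^ 2) (2 • innerSL ℝ x) x :=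
    (hasStrictFDerivAt_norm_sq x).hasFDerivAt
  have h2 := ((h1.const_mul (-(1 / 2))).exp).const_mul
    ((2 * Real.pi) ^ (Module.finrank ℝ V / 2 : ℝ))⁻¹
  refine h2.congr_fderiv ?_
  ext v
  simp [gaussianDensity]
  ring

lemma abs_inner_le_mul_one_add (a x : V) : |⟪a, x⟫| ≤ ‖a‖ * (1 + ‖x‖) :=
  (abs_real_inner_le_norm a x).trans (by gcongr; linarith)

variable [FiniteDimensional ℝ V] [MeasurableSpace V] [BorelSpace V]

lemma integral_cexp_gaussianDensity (t : V) :
    ∫ x, (gaussianDensity x : ℂ) * Complex.exp (⟪x, t⟫ * Complex.I)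
      = Complex.exp (-‖t‖ ^ 2 / 2) := by
  have h := GaussianFourier.integral_cexp_neg_mul_sq_norm_add (V := V) (b := 1 / 2) (by simp)
    Complex.I t
  have h2 : ∀ x : V, (gaussianDensity x : ℂ) * Complex.exp (⟪x, t⟫ * Complex.I)
      = (((2 * Real.pi) ^ (Module.finrank ℝ V / 2 : ℝ))⁻¹ : ℝ) *
        Complex.exp (-(1 / 2) * ‖x‖ ^ 2 + Complex.I * ⟪t, x⟫) := by
    intro x
    rw [Complex.exp_add, gaussianDensity, real_inner_comm]
    push_cast
    ring_nf
  simp_rw [h2]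
  rw [integral_const_mul, h]
  have h3 : (Real.pi / (1 / 2) : ℂ) ^ (Module.finrank ℝ V / 2 : ℂ)
      = (((2 * Real.pi) ^ (Module.finrank ℝ V / 2 : ℝ) : ℝ) : ℂ) := by
    rw [Complex.ofReal_cpow (by positivity)]
    push_cast
    congr 1
    ring
  rw [h3, ← mul_assoc, ← Complex.ofReal_mul, inv_mul_cancel₀ (by positivity)]
  simp
  congr 1
  ring

lemma integrable_gaussianDensity : Integrable (gaussianDensity : V → ℝ) := by
  have h := GaussianFourier.integrable_cexp_neg_mul_sq_norm_add (V := V) (b := 1 / 2) (by simp)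
    0 0
  refine (h.norm.const_mul ((2 * Real.pi) ^ (Module.finrank ℝ V / 2 : ℝ))⁻¹).congr ?_
  filter_upwards with x
  simp [gaussianDensity, Complex.norm_exp, ← Complex.ofReal_pow]

/-- Both finite measures have characteristic function exp(-‖t‖²/2). The explicit density is what
allows Lebesgue integration by parts. -/
lemma stdGaussian_eq_withDensity :
    stdGaussian V = (volume : Measure V).withDensity
      (fun x => ENNReal.ofReal (gaussianDensity x)) := by
  have : IsFiniteMeasure ((volume : Measure V).withDensity
      (fun x => ENNReal.ofReal (gaussianDensity x))) :=
    isFiniteMeasure_withDensity_ofReal integrable_gaussianDensity.2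
  apply Measure.ext_of_charFun
  ext t
  rw [charFun_stdGaussian, charFun_apply, integral_withDensity_eq_integral_toReal_smul
    (by have := continuous_gaussianDensity (V := V); fun_prop) (by simp)]
  rw [← integral_cexp_gaussianDensity]
  congr 1
  ext x
  rw [ENNReal.toReal_ofReal (gaussianDensity_nonneg x), Complex.real_smul]

lemma integrable_stdGaussian_iff {f : V → ℝ} :
    Integrable f (stdGaussian V) ↔ Integrable (fun x => gaussianDensity x * f x) := by
  rw [stdGaussian_eq_withDensity, integrable_withDensity_iff_integrable_smul'
    (by have := continuous_gaussianDensity (V := V); fun_prop) (by simp)]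
  simp [ENNReal.toReal_ofReal, gaussianDensity_nonneg]

lemma integral_stdGaussian_eq (f : V → ℝ) :
    ∫ x, f x ∂(stdGaussian V) = ∫ x, gaussianDensity x * f x := by
  rw [stdGaussian_eq_withDensity, integral_withDensity_eq_integral_toReal_smul
    (by have := continuous_gaussianDensity (V := V); fun_prop) (by simp)]
  simp [ENNReal.toReal_ofReal, gaussianDensity_nonneg]

/-- Gaussian integration by parts (Stein's identity). -/
lemma integral_inner_mul_stdGaussian {φ : V → ℝ} {φ' : V → V →L[ℝ] ℝ} (a : V)
    (hφ : ∀ x, HasFDerivAt φ (φ' x) x) (h0 : Integrable φ (stdGaussian V))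
    (h1 : Integrable (fun x => ⟪a, x⟫ * φ x) (stdGaussian V))
    (h2 : Integrable (fun x => φ' x a) (stdGaussian V)) :
    ∫ x, ⟪a, x⟫ * φ x ∂(stdGaussian V) = ∫ x, φ' x a ∂(stdGaussian V) := by
  rw [integrable_stdGaussian_iff] at h0 h1 h2
  rw [integral_stdGaussian_eq, integral_stdGaussian_eq]
  -- The weight ⟪a, x⟫ times the density is minus the derivative of the density along `a`.
  have e : ∀ x : V, gaussianDensity x * (⟪a, x⟫ * φ x)
      = -(((-gaussianDensity x) • innerSL ℝ x) a * φ x) := by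
    intro x
    simp [real_inner_comm]
    ring
  have key := integral_bilinear_hasFDerivAt_right_eq_neg_left_of_integrable
    (B := ContinuousLinearMap.mul ℝ ℝ) (μ := (volume : Measure V)) (v := a)
    (f := gaussianDensity) (f' := fun x => (-gaussianDensity x) • innerSL ℝ x)
    (g := φ) (g' := φ') (by
      simp_rw [e] at h1
      simpa using h1.neg) (by simpa using h2) (by simpa using h0)
      (fun x _ => hasFDerivAt_gaussianDensity x) (fun x _ => hφ x)
  simp_rw [e]
  rw [integral_neg]
  simpa using key.symm

lemma integrable_one_add_norm_pow (n : ℕ) :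
    Integrable (fun x : V => (1 + ‖x‖) ^ n) (stdGaussian V) := by
  have h1 : MemLp (fun x : V => ‖x‖) n (stdGaussian V) :=
    (IsGaussian.memLp_id (stdGaussian V) n (ENNReal.natCast_ne_top n)).norm
  have h2 : MemLp (fun _ : V => (1 : ℝ)) n (stdGaussian V) := memLp_const 1
  have h : MemLp (fun x : V => 1 + ‖x‖) n (stdGaussian V) := h2.add h1
  refine h.integrable_norm_pow'.congr (Filter.Eventually.of_forall fun x => ?_)
  show ‖1 + ‖x‖‖ ^ n = (1 + ‖x‖) ^ n
  rw [Real.norm_of_nonneg (by positivity)]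

/-- Continuous functions of polynomial growth are integrable for the standard Gaussian measure. -/
lemma integrable_of_growth {φ : V → ℝ} (hφ : Continuous φ) (C : ℝ) (n : ℕ)
    (h : ∀ x, |φ x| ≤ C * (1 + ‖x‖) ^ n) : Integrable φ (stdGaussian V) :=
  ((integrable_one_add_norm_pow n).const_mul C).mono' hφ.aestronglyMeasurable
    (Filter.Eventually.of_forall h)

lemma integral_inner_mul_inner (a b : V) :
    ∫ x, ⟪a, x⟫ * ⟪b, x⟫ ∂(stdGaussian V) = ⟪a, b⟫ := by
  rw [integral_inner_mul_stdGaussian a (φ := fun x => ⟪b, x⟫) (φ' := fun _ => innerSL ℝ b)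
    (fun x => (innerSL ℝ b).hasFDerivAt)]
  · simp [real_inner_comm]
  · exact integrable_of_growth (by fun_prop) ‖b‖ 1
      (fun x => by simpa using abs_inner_le_mul_one_add b x)
  · refine integrable_of_growth (by fun_prop) (‖a‖ * ‖b‖) 2 (fun x => ?_)
    rw [abs_mul]
    calc _ ≤ (‖a‖ * (1 + ‖x‖)) * (‖b‖ * (1 + ‖x‖)) := by
          gcongr <;> exact abs_inner_le_mul_one_add _ _
      _ = _ := by ring
  · simp

lemma integrable_norm_sq_pow (k : ℕ) :
    Integrable (fun x : V => (‖x‖ ^ 2) ^ k) (stdGaussian V) := by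
  refine integrable_of_growth (by fun_prop) 1 (2 * k) (fun x => ?_)
  rw [abs_of_nonneg (by positivity), one_mul, pow_mul]
  gcongr
  linarith

/-- Split one factor ‖x‖² as ∑ ⟪bᵢ, x⟫² over an orthonormal basis and apply Stein along each bᵢ.
Differentiating the linear factors contributes the dimension, differentiating the power contributes
2k. -/
lemma integral_norm_sq_pow_succ (k : ℕ) :
    ∫ x, (‖x‖ ^ 2) ^ (k + 1) ∂(stdGaussian V)
      = (Module.finrank ℝ V + 2 * k) * ∫ x, (‖x‖ ^ 2) ^ k ∂(stdGaussian V) := by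
  set b := stdOrthonormalBasis ℝ V with hb
  have hsum : ∀ x : V, ∑ i, ⟪b i, x⟫ ^ 2 = ‖x‖ ^ 2 := b.sum_sq_inner_right
  have hbi : ∀ i (x : V), |⟪b i, x⟫| ≤ 1 + ‖x‖ := fun i x => by
    simpa using abs_inner_le_mul_one_add (b i) x
  have hx2 : ∀ (x : V) (j : ℕ), |(‖x‖ ^ 2) ^ j| ≤ (1 + ‖x‖) ^ (2 * j) := fun x j => by
    rw [abs_of_nonneg (by positivity), pow_mul]
    gcongr
    linarith
  have hI2 : ∀ i, Integrable (fun x : V => ⟪b i, x⟫ * (⟪b i, x⟫ * (‖x‖ ^ 2) ^ k))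
      (stdGaussian V) := fun i => by
    refine integrable_of_growth (by fun_prop) 1 (1 + (1 + 2 * k)) (fun x => ?_)
    rw [abs_mul, abs_mul, one_mul, pow_add, pow_add, pow_one]
    have := hbi i x
    have := hx2 x k
    gcongr
  have hI3 : ∀ i, Integrable (fun x : V => (‖x‖ ^ 2) ^ k
      + 2 * k * (⟪b i, x⟫ ^ 2 * (‖x‖ ^ 2) ^ (k - 1))) (stdGaussian V) := fun i => by
    refine (integrable_norm_sq_pow k).add (Integrable.const_mul ?_ _)
    refine integrable_of_growth (by fun_prop) 1 (2 + 2 * (k - 1)) (fun x => ?_)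
    rw [abs_mul, abs_pow, one_mul, pow_add]
    have := hbi i x
    have := hx2 x (k - 1)
    gcongr
  have hstein : ∀ i, ∫ x, ⟪b i, x⟫ * (⟪b i, x⟫ * (‖x‖ ^ 2) ^ k) ∂(stdGaussian V)
      = ∫ x, ((‖x‖ ^ 2) ^ k + 2 * k * (⟪b i, x⟫ ^ 2 * (‖x‖ ^ 2) ^ (k - 1)))
        ∂(stdGaussian V) := fun i => by
    have hd : ∀ x : V, HasFDerivAt (fun x : V => ⟪b i, x⟫ * (‖x‖ ^ 2) ^ k)
        (⟪b i, x⟫ • ((k * (‖x‖ ^ 2) ^ (k - 1)) • (2 • innerSL ℝ x))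
          + (‖x‖ ^ 2) ^ k • innerSL ℝ (b i)) x := fun x => by
      have h1 : HasFDerivAt (fun y : V => ‖y‖ ^ 2) (2 • innerSL ℝ x) x :=
        (hasStrictFDerivAt_norm_sq x).hasFDerivAt
      have h2 : HasFDerivAt (fun y : V => (‖y‖ ^ 2) ^ k)
        ((k * (‖x‖ ^ 2) ^ (k - 1)) • (2 • innerSL ℝ x)) x := by
        have := (hasDerivAt_pow k (‖x‖ ^ 2)).comp_hasFDerivAt x h1
        exact this
      exact ((innerSL ℝ (b i)).hasFDerivAt).mul h2
    have hval : ∀ x : V, (⟪b i, x⟫ • ((k * (‖x‖ ^ 2) ^ (k - 1)) • (2 • innerSL ℝ x))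
          + (‖x‖ ^ 2) ^ k • innerSL ℝ (b i)) (b i)
          = (‖x‖ ^ 2) ^ k + 2 * k * (⟪b i, x⟫ ^ 2 * (‖x‖ ^ 2) ^ (k - 1)) := fun x => by
      simp [real_inner_comm (b i) x]
      ring
    rw [integral_inner_mul_stdGaussian (b i) hd]
    · simp_rw [hval]
    · refine integrable_of_growth (by fun_prop) 1 (1 + 2 * k) (fun x => ?_)
      rw [abs_mul, one_mul, pow_add, pow_one]
      have := hbi i x
      have := hx2 x k
      gcongr
    · exact hI2 i
    · simp_rw [hval]
      exact hI3 i
  have hl : ∀ x : V, (‖x‖ ^ 2) ^ (k + 1) = ∑ i, ⟪b i, x⟫ * (⟪b i, x⟫ * (‖x‖ ^ 2) ^ k) := by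
    intro x
    rw [pow_succ, mul_comm, ← hsum x, Finset.sum_mul]
    refine Finset.sum_congr rfl fun i _ => by ring
  have hr : ∀ x : V, ∑ i, ((‖x‖ ^ 2) ^ k + 2 * k * (⟪b i, x⟫ ^ 2 * (‖x‖ ^ 2) ^ (k - 1)))
      = (Module.finrank ℝ V + 2 * k) * (‖x‖ ^ 2) ^ k := by
    intro x
    rw [Finset.sum_add_distrib, ← Finset.mul_sum, ← Finset.sum_mul, hsum]
    -- For k = 0 the exponent k - 1 is truncated, but the coefficient 2k vanishes.
    rcases k with _ | k
    · simp
    · simp [pow_succ]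
      ring
  simp_rw [hl]
  rw [integral_finsetSum _ (fun i _ => hI2 i)]
  simp_rw [hstein]
  rw [← integral_finsetSum _ (fun i _ => hI3 i)]
  simp_rw [hr]
  rw [integral_const_mul]

lemma integral_norm_sq_stdGaussian :
    ∫ x, ‖x‖ ^ 2 ∂(stdGaussian V) = Module.finrank ℝ V := by
  simpa using integral_norm_sq_pow_succ (V := V) 0

lemma integral_norm_pow_four :
    ∫ x, (‖x‖ ^ 2) ^ 2 ∂(stdGaussian V) = Module.finrank ℝ V * (Module.finrank ℝ V + 2) := by
  rw [integral_norm_sq_pow_succ 1]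
  simp [integral_norm_sq_stdGaussian]
  ring

lemma integral_norm_pow_six :
    ∫ x, (‖x‖ ^ 2) ^ 3 ∂(stdGaussian V)
      = Module.finrank ℝ V * (Module.finrank ℝ V + 2) * (Module.finrank ℝ V + 4) := by
  rw [integral_norm_sq_pow_succ 2, integral_norm_pow_four]
  push_cast
  ring

lemma integral_norm_pow_eight :
    ∫ x, (‖x‖ ^ 2) ^ 4 ∂(stdGaussian V) = Module.finrank ℝ V * (Module.finrank ℝ V + 2)
      * (Module.finrank ℝ V + 4) * (Module.finrank ℝ V + 6) := by
  rw [integral_norm_sq_pow_succ 3, integral_norm_pow_six]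
  push_cast
  ring

lemma integrable_inner_sq (a : V) : Integrable (fun x : V => ⟪a, x⟫ ^ 2) (stdGaussian V) := by
  refine integrable_of_growth (by fun_prop) (‖a‖ ^ 2) 2 (fun x => ?_)
  rw [abs_pow, ← mul_pow]
  have := abs_inner_le_mul_one_add a x
  gcongr

lemma integrable_inner_sq_mul_norm_sq (a : V) :
    Integrable (fun x : V => ⟪a, x⟫ ^ 2 * ‖x‖ ^ 2) (stdGaussian V) := by
  refine integrable_of_growth (by fun_prop) (‖a‖ ^ 2) 4 (fun x => ?_)
  rw [abs_mul, abs_pow, abs_of_nonneg (sq_nonneg ‖x‖)]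
  calc _ ≤ (‖a‖ * (1 + ‖x‖)) ^ 2 * (1 + ‖x‖) ^ 2 := by
        have := abs_inner_le_mul_one_add a x
        gcongr
        linarith
    _ = _ := by ring

lemma integral_inner_sq (a : V) : ∫ x, ⟪a, x⟫ ^ 2 ∂(stdGaussian V) = ‖a‖ ^ 2 := by
  rw [← real_inner_self_eq_norm_sq, ← integral_inner_mul_inner]
  simp_rw [sq]

/-- Stein along `a` for ⟪a, x⟫‖x‖², whose derivative is 2⟪a, x⟫² + ‖a‖²‖x‖². Using this in place of
Cauchy–Schwarz keeps the variance linear in the dimension. -/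
lemma integral_inner_sq_mul_norm_sq (a : V) :
    ∫ x, ⟪a, x⟫ ^ 2 * ‖x‖ ^ 2 ∂(stdGaussian V) = (Module.finrank ℝ V + 2) * ‖a‖ ^ 2 := by
  have hd : ∀ x : V, HasFDerivAt (fun x : V => ⟪a, x⟫ * ‖x‖ ^ 2)
      (⟪a, x⟫ • (2 • innerSL ℝ x) + ‖x‖ ^ 2 • innerSL ℝ a) x := fun x =>
    ((innerSL ℝ a).hasFDerivAt).mul (hasStrictFDerivAt_norm_sq x).hasFDerivAt
  have hval : ∀ x : V, (⟪a, x⟫ • (2 • innerSL ℝ x) + ‖x‖ ^ 2 • innerSL ℝ a) a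
      = 2 * ⟪a, x⟫ ^ 2 + ‖a‖ ^ 2 * ‖x‖ ^ 2 := fun x => by
    simp [real_inner_comm a x]
    ring
  have hn : Integrable (fun x : V => ‖x‖ ^ 2) (stdGaussian V) := by
    simpa using integrable_norm_sq_pow (V := V) 1
  have e : ∀ x : V, ⟪a, x⟫ ^ 2 * ‖x‖ ^ 2 = ⟪a, x⟫ * (⟪a, x⟫ * ‖x‖ ^ 2) := fun x => by ring
  have hI := integrable_inner_sq_mul_norm_sq a
  simp_rw [e] at hI ⊢
  rw [integral_inner_mul_stdGaussian a hd _ hI]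
  · simp_rw [hval]
    rw [integral_add ((integrable_inner_sq a).const_mul _) (hn.const_mul _), integral_const_mul,
      integral_const_mul, integral_inner_sq, integral_norm_sq_stdGaussian]
    ring
  · simp_rw [hval]
    exact ((integrable_inner_sq a).const_mul _).add (hn.const_mul _)
  · refine integrable_of_growth (by fun_prop) ‖a‖ 3 (fun x => ?_)
    rw [abs_mul, abs_of_nonneg (sq_nonneg ‖x‖)]
    calc _ ≤ (‖a‖ * (1 + ‖x‖)) * (1 + ‖x‖) ^ 2 := by
          have := abs_inner_le_mul_one_add a x
          gcongr
          linarith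
      _ = _ := by ring

end Gaussian

end

/-! ### Taylor estimates along lines, and the Hessian of a convex function. -/

section

/-- Comparison with the primitive of K tⁿ by a mean value inequality, so `ψ'` need not be
integrable. Iterating it replaces Taylor's formula with remainder. -/
lemma abs_le_of_abs_deriv_le {ψ ψ' : ℝ → ℝ} {K : ℝ} {n : ℕ} (hψ : ∀ t, HasDerivAt ψ (ψ' t) t)
    (h0 : ψ 0 = 0) (h : ∀ t, 0 ≤ t → |ψ' t| ≤ K * t ^ n) (t : ℝ) (ht : 0 ≤ t) :
    |ψ t| ≤ K / (n + 1) * t ^ (n + 1) := by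
  have hB : ∀ s : ℝ, HasDerivAt (fun s : ℝ => K / (n + 1) * s ^ (n + 1)) (K * s ^ n) s := by
    intro s
    refine ((hasDerivAt_pow (n + 1) s).const_mul (K / (n + 1))).congr_deriv ?_
    push_cast
    field_simp
  exact image_norm_le_of_norm_deriv_right_le_deriv_boundary (a := 0) (b := t) (f := ψ) (f' := ψ')
    (fun s _ => (hψ s).continuousAt.continuousWithinAt) (fun s _ => (hψ s).hasDerivWithinAt)
    (B := fun s => K / (n + 1) * s ^ (n + 1)) (B' := fun s => K * s ^ n) (by simp [h0])
    hB (fun s hs => h s hs.1) ⟨ht, le_rfl⟩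

lemma hasDerivAt_comp_neg_of {ψ ψ' : ℝ → ℝ} (hψ : ∀ t, HasDerivAt ψ (ψ' t) t) (t : ℝ) :
    HasDerivAt (fun t => ψ (-t)) (-ψ' (-t)) t := by
  simpa [Function.comp_def] using (hψ (-t)).comp t (hasDerivAt_neg t)

/-- Error of the central difference quotient. -/
lemma central_difference_bound {p0 p1 p2 : ℝ → ℝ} {K : ℝ} (h0 : ∀ t, HasDerivAt p0 (p1 t) t)
    (h1 : ∀ t, HasDerivAt p1 (p2 t) t) (h2 : ∀ s t, |p2 s - p2 t| ≤ K * |s - t|)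
    (t : ℝ) (ht : 0 ≤ t) : |p0 t - p0 (-t) - 2 * t * p1 0| ≤ K / 3 * t ^ 3 := by
  -- The Lipschitz bound is applied to the symmetric pair t, -t, at distance 2t. Two integrations
  -- then turn 2Kt into Kt² and Kt³/3.
  have b1 := abs_le_of_abs_deriv_le (ψ := fun t => p1 t + p1 (-t) - 2 * p1 0)
    (ψ' := fun t => p2 t - p2 (-t)) (K := 2 * K) (n := 1)
    (fun t => (((h1 t).add (hasDerivAt_comp_neg_of h1 t)).sub_const _).congr_deriv (by ring))
    (by simp; ring) (fun t ht => by
      have := h2 t (-t)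
      rw [show t - -t = 2 * t by ring, abs_of_nonneg (a := 2 * t) (by positivity)] at this
      linarith)
  have b0 := abs_le_of_abs_deriv_le (ψ := fun t => p0 t - p0 (-t) - 2 * t * p1 0)
    (ψ' := fun t => p1 t + p1 (-t) - 2 * p1 0) (K := K) (n := 2)
    (fun t => (((h0 t).sub (hasDerivAt_comp_neg_of h0 t)).sub
      (((hasDerivAt_id t).const_mul 2).mul_const (p1 0))).congr_deriv (by ring))
    (by simp) (fun t ht => by
      have := b1 t ht
      norm_num at this ⊢
      linarith) t ht
  norm_num at b0 ⊢
  linarith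

/-- Error of the second central difference. -/
lemma second_difference_bound {p0 p1 p2 p3 : ℝ → ℝ} {K : ℝ}
    (h0 : ∀ t, HasDerivAt p0 (p1 t) t) (h1 : ∀ t, HasDerivAt p1 (p2 t) t)
    (h2 : ∀ t, HasDerivAt p2 (p3 t) t) (h3 : ∀ s t, |p3 s - p3 t| ≤ K * |s - t|)
    (t : ℝ) (ht : 0 ≤ t) :
    |p0 t + p0 (-t) - 2 * p0 0 - t ^ 2 * p2 0| ≤ K / 12 * t ^ 4 := by
  have b2 := abs_le_of_abs_deriv_le (ψ := fun t => p2 t + p2 (-t) - 2 * p2 0)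
    (ψ' := fun t => p3 t - p3 (-t)) (K := 2 * K) (n := 1)
    (fun t => (((h2 t).add (hasDerivAt_comp_neg_of h2 t)).sub_const _).congr_deriv (by ring))
    (by simp; ring) (fun t ht => by
      have := h3 t (-t)
      rw [show t - -t = 2 * t by ring, abs_of_nonneg (a := 2 * t) (by positivity)] at this
      linarith)
  have b1 := abs_le_of_abs_deriv_le (ψ := fun t => p1 t - p1 (-t) - 2 * t * p2 0)
    (ψ' := fun t => p2 t + p2 (-t) - 2 * p2 0) (K := K) (n := 2)
    (fun t => (((h1 t).sub (hasDerivAt_comp_neg_of h1 t)).sub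
      (((hasDerivAt_id t).const_mul 2).mul_const (p2 0))).congr_deriv (by ring))
    (by simp) (fun t ht => by
      have := b2 t ht
      norm_num at this ⊢
      linarith)
  have b0 := abs_le_of_abs_deriv_le (ψ := fun t => p0 t + p0 (-t) - 2 * p0 0 - t ^ 2 * p2 0)
    (ψ' := fun t => p1 t - p1 (-t) - 2 * t * p2 0) (K := K / 3) (n := 3)
    (fun t => ((((h0 t).add (hasDerivAt_comp_neg_of h0 t)).sub_const _).sub
      ((hasDerivAt_pow 2 t).mul_const (p2 0))).congr_deriv (by simp; ring))
    (by simp; ring) (fun t ht => by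
      have := b1 t ht
      norm_num at this ⊢
      linarith) t ht
  norm_num at b0 ⊢
  linarith

variable {d : ℕ} {f : E d → ℝ} {L₁ L₂ L₃ : ℝ}

/-- Homogeneity of degree `r` extends the unit-ball bound to every direction. At s = 0 both forms
vanish because r ≠ 0. -/
lemma OrderSmooth.abs_sub_le {r : ℕ} {L : ℝ} (hr : r ≠ 0) (h : OrderSmooth r L f) (x y s : E d) :
    |iteratedFDeriv ℝ r f x (fun _ => s) - iteratedFDeriv ℝ r f y (fun _ => s)|
      ≤ L * ‖x - y‖ * ‖s‖ ^ r := by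
  have key : ∀ z, iteratedFDeriv ℝ r f z (fun _ => s)
      = ‖s‖ ^ r * iteratedFDeriv ℝ r f z (fun _ => ‖s‖⁻¹ • s) := by
    intro z
    rcases eq_or_ne s 0 with rfl | hs
    · have : iteratedFDeriv ℝ r f z (fun _ => (0 : E d)) = 0 :=
        (iteratedFDeriv ℝ r f z).map_coord_zero ⟨0, Nat.pos_of_ne_zero hr⟩ rfl
      simp [this]
    · have h1 := (iteratedFDeriv ℝ r f z).map_smul_univ (fun _ => ‖s‖⁻¹) (fun _ => s)
      rw [h1]
      have : ‖s‖ ≠ 0 := norm_ne_zero_iff.2 hs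
      simp [this]
  rw [key x, key y, ← mul_sub, abs_mul, abs_of_nonneg (by positivity), mul_comm]
  gcongr
  refine h.2 x y _ ?_
  rw [norm_smul, norm_inv, norm_norm]
  exact inv_mul_le_one

lemma hasDerivAt_iteratedFDeriv_line (hf : ContDiff ℝ 3 f) {k : ℕ} (hk : k < 3) (x u : E d)
    (t : ℝ) :
    HasDerivAt (fun t : ℝ => iteratedFDeriv ℝ k f (x + t • u) (fun _ => u))
      (iteratedFDeriv ℝ (k + 1) f (x + t • u) (fun _ => u)) t := by
  have h1 : DifferentiableAt ℝ (iteratedFDeriv ℝ k f) (x + t • u) :=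
    (hf.differentiable_iteratedFDeriv (by exact_mod_cast hk)) _
  have h2 : HasDerivAt (fun t : ℝ => x + t • u) u t := by
    simpa using ((hasDerivAt_id t).smul_const u).const_add x
  have h3 := h1.hasFDerivAt.comp_hasDerivAt t h2
  have h4 := ((ContinuousMultilinearMap.apply ℝ (fun _ : Fin k => E d) ℝ
    (fun _ => u)).hasFDerivAt).comp_hasDerivAt t h3
  exact h4

lemma OrderSmooth.abs_line_sub_le {r : ℕ} {L : ℝ} (hr : r ≠ 0) (h : OrderSmooth r L f)
    (x u : E d) (s t : ℝ) :
    |iteratedFDeriv ℝ r f (x + s • u) (fun _ => u) - iteratedFDeriv ℝ r f (x + t • u) (fun _ => u)|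
      ≤ L * ‖u‖ ^ (r + 1) * |s - t| := by
  refine (h.abs_sub_le hr _ _ u).trans (le_of_eq ?_)
  rw [show x + s • u - (x + t • u) = (s - t) • u by module, norm_smul, Real.norm_eq_abs]
  ring

lemma iteratedFDeriv_one_const (x u : E d) :
    iteratedFDeriv ℝ 1 f x (fun _ => u) = fderiv ℝ f x u := by
  simp [iteratedFDeriv_one_apply]

lemma Smoothness.abs_central_difference_le (h : Smoothness f L₁ L₂ L₃) (x u : E d) {t : ℝ}
    (ht : 0 ≤ t) :
    |f (x + t • u) - f (x - t • u) - 2 * t * fderiv ℝ f x u| ≤ L₂ * ‖u‖ ^ 3 / 3 * t ^ 3 := by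
  have := central_difference_bound (hasDerivAt_iteratedFDeriv_line h.contDiff (k := 0) (by simp) x u)
    (hasDerivAt_iteratedFDeriv_line h.contDiff (by simp) x u)
    (h.second.abs_line_sub_le (by simp) x u) t ht
  simpa [iteratedFDeriv_one_const, sub_eq_add_neg] using this

lemma Smoothness.abs_second_difference_le (h : Smoothness f L₁ L₂ L₃) (x u : E d) {t : ℝ}
    (ht : 0 ≤ t) :
    |f (x + t • u) + f (x - t • u) - 2 * f x - t ^ 2 * iteratedFDeriv ℝ 2 f x (fun _ => u)|
      ≤ L₃ * ‖u‖ ^ 4 / 12 * t ^ 4 := by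
  have := second_difference_bound (hasDerivAt_iteratedFDeriv_line h.contDiff (k := 0) (by simp) x u)
    (hasDerivAt_iteratedFDeriv_line h.contDiff (by simp) x u)
    (hasDerivAt_iteratedFDeriv_line h.contDiff (by simp) x u)
    (h.third.abs_line_sub_le (by simp) x u) t ht
  simpa [sub_eq_add_neg] using this

lemma Smoothness.abs_fderiv_sub_le (h : Smoothness f L₁ L₂ L₃) (x y s : E d) :
    |fderiv ℝ f x s - fderiv ℝ f y s| ≤ L₁ * ‖x - y‖ * ‖s‖ := by
  simpa [iteratedFDeriv_one_const] using h.first.abs_sub_le (by simp) x y s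

lemma Smoothness.norm_fderiv_sub_le (h : Smoothness f L₁ L₂ L₃) (hL : 0 ≤ L₁) (x y : E d) :
    ‖fderiv ℝ f x - fderiv ℝ f y‖ ≤ L₁ * ‖x - y‖ :=
  ContinuousLinearMap.opNorm_le_bound _ (by positivity) (fun s => h.abs_fderiv_sub_le x y s)

lemma Smoothness.abs_sub_sub_fderiv_le (h : Smoothness f L₁ L₂ L₃) (x u : E d) :
    |f (x + u) - f x - fderiv ℝ f x u| ≤ L₁ / 2 * ‖u‖ ^ 2 := by
  have h0 := hasDerivAt_iteratedFDeriv_line h.contDiff (k := 0) (by simp) x u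
  have h1 := h.first.abs_line_sub_le (by simp) x u
  have := abs_le_of_abs_deriv_le (n := 1) (K := L₁ * ‖u‖ ^ 2)
    (fun t => ((h0 t).sub_const (f x)).sub ((hasDerivAt_id t).mul_const (fderiv ℝ f x u)))
    (by simp) (fun t ht => by
      have := h1 t 0
      simpa [iteratedFDeriv_one_const, abs_of_nonneg ht] using this) 1 zero_le_one
  norm_num at this
  linarith

/-- The second derivative along u is the derivative of a function of t that is Lipschitz with
constant L₁‖u‖². -/
lemma Smoothness.iteratedFDeriv_two_le (h : Smoothness f L₁ L₂ L₃) (hL : 0 ≤ L₁) (x u : E d) :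
    iteratedFDeriv ℝ 2 f x (fun _ => u) ≤ L₁ * ‖u‖ ^ 2 := by
  have h1 := hasDerivAt_iteratedFDeriv_line h.contDiff (k := 1) (by simp) x u 0
  have h2 := h.first.abs_line_sub_le (by simp) x u
  have hl : LipschitzWith (Real.toNNReal (L₁ * ‖u‖ ^ 2))
      (fun t : ℝ => iteratedFDeriv ℝ 1 f (x + t • u) (fun _ => u)) :=
    LipschitzWith.of_dist_le_mul fun s t => by
      rw [Real.dist_eq, Real.dist_eq, Real.coe_toNNReal _ (by positivity)]
      exact h2 s t
  have := norm_deriv_le_of_lipschitz (x₀ := (0 : ℝ)) hl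
  rw [h1.deriv, Real.coe_toNNReal _ (by positivity)] at this
  simpa using (le_abs_self _).trans this

lemma fderiv_sub_le_of_convex (hc : ConvexOn ℝ Set.univ f) (hf : Differentiable ℝ f) (x y : E d) :
    f x - f y ≤ fderiv ℝ f x (x - y) := by
  have hd : HasDerivAt (fun t : ℝ => f (x + t • (y - x))) (fderiv ℝ f x (y - x)) 0 := by
    have h2 : HasDerivAt (fun t : ℝ => x + t • (y - x)) (y - x) 0 := by
      simpa using ((hasDerivAt_id (0 : ℝ)).smul_const (y - x)).const_add x
    have h3 : HasFDerivAt f (fderiv ℝ f x) (x + (0 : ℝ) • (y - x)) := by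
      simpa using (hf x).hasFDerivAt
    exact h3.comp_hasDerivAt (0 : ℝ) h2
  have hcl : ConvexOn ℝ Set.univ (fun t : ℝ => f (x + t • (y - x))) := by
    have := hc.comp_affineMap (AffineMap.lineMap x y : ℝ →ᵃ[ℝ] E d)
    simpa [Function.comp_def, AffineMap.lineMap_apply, add_comm] using this
  have := hcl.le_slope_of_hasDerivAt (x := 0) (y := 1) (Set.mem_univ _) (Set.mem_univ _)
    zero_lt_one hd
  simp [slope_def_field] at this
  have e : fderiv ℝ f x (x - y) = -fderiv ℝ f x (y - x) := by rw [← map_neg, neg_sub]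
  rw [e, map_sub]
  linarith

/-- Adding the gradient inequality at two points of a line makes the directional derivative monotone
along it, so its derivative is nonnegative. -/
lemma iteratedFDeriv_two_nonneg (hf : ContDiff ℝ 3 f) (hc : ConvexOn ℝ Set.univ f) (x u : E d) :
    0 ≤ iteratedFDeriv ℝ 2 f x (fun _ => u) := by
  have h1 := hasDerivAt_iteratedFDeriv_line hf (k := 1) (by simp) x u 0
  have hm : Monotone (fun t : ℝ => iteratedFDeriv ℝ 1 f (x + t • u) (fun _ => u)) := by
    intro s t hst
    rcases hst.eq_or_lt with rfl | hst
    · exact le_rfl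
    simp only [iteratedFDeriv_one_const]
    have hd : Differentiable ℝ f := hf.differentiable (by simp)
    have a1 := fderiv_sub_le_of_convex hc hd (x + s • u) (x + t • u)
    have a2 := fderiv_sub_le_of_convex hc hd (x + t • u) (x + s • u)
    rw [show x + s • u - (x + t • u) = -((t - s) • u) by module, map_neg, map_smul] at a1
    rw [show x + t • u - (x + s • u) = (t - s) • u by module, map_smul] at a2
    simp only [smul_eq_mul] at a1 a2
    have : (t - s) * fderiv ℝ f (x + s • u) u ≤ (t - s) * fderiv ℝ f (x + t • u) u := by linarith
    exact le_of_mul_le_mul_left this (by linarith)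
  simpa using h1.nonneg_of_monotone hm

lemma trHess_eq_sum (f : E d → ℝ) (x : E d) :
    trHess f x = ∑ i, iteratedFDeriv ℝ 2 f x (fun _ => EuclideanSpace.single i 1) := by
  simp only [trHess, hessian, Matrix.trace, Matrix.diag, Matrix.of_apply]
  refine Finset.sum_congr rfl fun i _ => ?_
  congr 1
  ext j
  fin_cases j <;> rfl

lemma trHess_nonneg (hf : ContDiff ℝ 3 f) (hc : ConvexOn ℝ Set.univ f) (x : E d) :
    0 ≤ trHess f x := by
  rw [trHess_eq_sum]
  exact Finset.sum_nonneg fun i _ => iteratedFDeriv_two_nonneg hf hc x _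

lemma Smoothness.trHess_le (h : Smoothness f L₁ L₂ L₃) (hL : 0 ≤ L₁) (x : E d) :
    trHess f x ≤ d * L₁ := by
  rw [trHess_eq_sum]
  refine (Finset.sum_le_sum fun i _ => h.iteratedFDeriv_two_le hL x _).trans ?_
  simp

lemma continuous_trHess (hf : ContDiff ℝ 3 f) : Continuous (trHess f) := by
  have : trHess f = fun x => ∑ i, iteratedFDeriv ℝ 2 f x (fun _ => EuclideanSpace.single i 1) :=
    funext (trHess_eq_sum f)
  rw [this]
  have h2 : Continuous (iteratedFDeriv ℝ 2 f) := hf.continuous_iteratedFDeriv (by norm_num)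
  refine continuous_finsetSum _ fun i _ => ?_
  exact (ContinuousMultilinearMap.apply ℝ (fun _ : Fin 2 => E d) ℝ
    (fun _ => EuclideanSpace.single i 1)).continuous.comp h2

open scoped RealInnerProductSpace in
lemma iteratedFDeriv_two_eq_sum (f : E d → ℝ) (x u : E d) :
    iteratedFDeriv ℝ 2 f x (fun _ => u) = ∑ i, ∑ j, (⟪EuclideanSpace.single i 1, u⟫ *
      ⟪EuclideanSpace.single j 1, u⟫) * hessian f x i j := by
  have hu : u = ∑ i, u i • (EuclideanSpace.single i 1 : E d) := by
    have := (EuclideanSpace.basisFun (Fin d) ℝ).sum_repr u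
    simpa using this.symm
  have h0 : (fun _ : Fin 2 => u) = ![u, u] := by ext j; fin_cases j <;> rfl
  have key : ∀ v w : E d, iteratedFDeriv ℝ 2 f x ![v, w] = fderiv ℝ (fderiv ℝ f) x v w := by
    intro v w
    rw [iteratedFDeriv_two_apply]
    simp
  simp only [hessian, Matrix.of_apply, key, h0]
  conv_lhs => rw [hu]
  rw [Finset.sum_comm]
  simp only [map_sum, map_smul, sum_apply, smul_apply,
    smul_eq_mul, Finset.mul_sum, EuclideanSpace.inner_single_left, map_one, one_mul]
  refine Finset.sum_congr rfl fun i _ => Finset.sum_congr rfl fun j _ => by ring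

end

/-! ### Gaussian smoothing, the estimator, and the one-step inequality. -/

section

open scoped RealInnerProductSpace

lemma integral_comp_neg_stdGaussian {V : Type*} [NormedAddCommGroup V] [InnerProductSpace ℝ V]
    [FiniteDimensional ℝ V] [MeasurableSpace V] [BorelSpace V] (φ : V → ℝ) :
    ∫ u, φ (-u) ∂(stdGaussian V) = ∫ u, φ u ∂(stdGaussian V) := by
  rw [integral_stdGaussian_eq, integral_stdGaussian_eq,
    ← integral_neg_eq_self (fun u : V => gaussianDensity u * φ u)]
  simp [gaussianDensity]

variable {d : ℕ} {f : E d → ℝ} {L₁ L₂ L₃ : ℝ}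

/-- The Gaussian smoothing `f_λ(x) = 𝔼 f(x + λu)`. -/
noncomputable def smoothed (f : E d → ℝ) (lam : ℝ) (x : E d) : ℝ :=
  ∫ u, f (x + lam • u) ∂(stdGaussian (E d))

/-- The mean of the two-point estimator. -/
noncomputable def meanEstimator (f : E d → ℝ) (lam : ℝ) (x : E d) : E d :=
  ∫ u, twoPoint f lam x u ∂(stdGaussian (E d))

lemma Smoothness.differentiable (h : Smoothness f L₁ L₂ L₃) : Differentiable ℝ f :=
  h.contDiff.differentiable (by simp)

lemma Smoothness.continuous (h : Smoothness f L₁ L₂ L₃) : Continuous f := h.contDiff.continuous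

lemma Smoothness.continuous_fderiv (h : Smoothness f L₁ L₂ L₃) : Continuous (fderiv ℝ f) :=
  h.contDiff.continuous_fderiv (by simp)

lemma Smoothness.abs_le_growth (h : Smoothness f L₁ L₂ L₃) (hL : 0 ≤ L₁) (x u : E d) (s : ℝ) :
    |f (x + s • u)| ≤ (|f x| + ‖fderiv ℝ f x‖ * |s| + L₁ / 2 * s ^ 2) * (1 + ‖u‖) ^ 2 := by
  have h1 := h.abs_sub_sub_fderiv_le x (s • u)
  have h2 : |fderiv ℝ f x (s • u)| ≤ ‖fderiv ℝ f x‖ * |s| * ‖u‖ := by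
    have := (fderiv ℝ f x).le_opNorm (s • u)
    rwa [norm_smul, Real.norm_eq_abs, Real.norm_eq_abs, ← mul_assoc] at this
  have h3 : |f (x + s • u)| ≤ |f x| + |fderiv ℝ f x (s • u)| + L₁ / 2 * ‖s • u‖ ^ 2 := by
    have := abs_add_three (f (x + s • u) - f x - fderiv ℝ f x (s • u)) (f x)
      (fderiv ℝ f x (s • u))
    rw [show f (x + s • u) - f x - fderiv ℝ f x (s • u) + f x + fderiv ℝ f x (s • u)
      = f (x + s • u) by ring] at this
    linarith
  rw [norm_smul, mul_pow, Real.norm_eq_abs, sq_abs] at h3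
  have hu := norm_nonneg u
  have a1 : |f x| * 1 ≤ |f x| * (1 + ‖u‖) ^ 2 := by
    gcongr; nlinarith
  have a2 : ‖fderiv ℝ f x‖ * |s| * ‖u‖ ≤ ‖fderiv ℝ f x‖ * |s| * (1 + ‖u‖) ^ 2 := by
    gcongr; nlinarith
  have a3 : L₁ / 2 * s ^ 2 * ‖u‖ ^ 2 ≤ L₁ / 2 * s ^ 2 * (1 + ‖u‖) ^ 2 := by
    gcongr; linarith
  linarith

lemma Smoothness.abs_fderiv_le_growth (h : Smoothness f L₁ L₂ L₃) (hL : 0 ≤ L₁) (x u a : E d)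
    (s : ℝ) :
    |fderiv ℝ f (x + s • u) a| ≤ ((‖fderiv ℝ f x‖ + L₁ * |s|) * ‖a‖) * (1 + ‖u‖) ^ 1 := by
  have h1 := h.abs_fderiv_sub_le (x + s • u) x a
  have h2 := (fderiv ℝ f x).le_opNorm a
  rw [Real.norm_eq_abs] at h2
  rw [add_sub_cancel_left, norm_smul, Real.norm_eq_abs] at h1
  have h3 : |fderiv ℝ f (x + s • u) a| ≤ |fderiv ℝ f x a| + L₁ * (|s| * ‖u‖) * ‖a‖ := by
    have := abs_sub_abs_le_abs_sub (fderiv ℝ f (x + s • u) a) (fderiv ℝ f x a)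
    linarith
  have p1 : 0 ≤ ‖fderiv ℝ f x‖ * ‖a‖ * ‖u‖ := by positivity
  have p2 : 0 ≤ L₁ * |s| * ‖a‖ := by positivity
  nlinarith

lemma Smoothness.integrable_line (h : Smoothness f L₁ L₂ L₃) (hL : 0 ≤ L₁) (x : E d) (s : ℝ) :
    Integrable (fun u => f (x + s • u)) (stdGaussian (E d)) :=
  integrable_of_growth (h.continuous.comp (by fun_prop)) _ 2 (fun u => h.abs_le_growth hL x u s)

lemma Smoothness.integrable_fderiv_line (h : Smoothness f L₁ L₂ L₃) (hL : 0 ≤ L₁) (x a : E d)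
    (s : ℝ) : Integrable (fun u => fderiv ℝ f (x + s • u) a) (stdGaussian (E d)) := by
  refine integrable_of_growth ?_ _ 1 (fun u => h.abs_fderiv_le_growth hL x u a s)
  exact (h.continuous_fderiv.comp (by fun_prop : Continuous fun u : E d => x + s • u)).clm_apply
    continuous_const

lemma Smoothness.integrable_inner_mul_line (h : Smoothness f L₁ L₂ L₃) (hL : 0 ≤ L₁) (x a : E d)
    (s : ℝ) : Integrable (fun u => ⟪a, u⟫ * f (x + s • u)) (stdGaussian (E d)) := by
  have hc := h.continuous
  refine integrable_of_growth (by fun_prop)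
    (‖a‖ * (|f x| + ‖fderiv ℝ f x‖ * |s| + L₁ / 2 * s ^ 2)) 3 (fun u => ?_)
  rw [abs_mul]
  calc _ ≤ (‖a‖ * (1 + ‖u‖)) *
        ((|f x| + ‖fderiv ℝ f x‖ * |s| + L₁ / 2 * s ^ 2) * (1 + ‖u‖) ^ 2) := by
        gcongr
        · exact abs_inner_le_mul_one_add a u
        · exact h.abs_le_growth hL x u s
    _ = _ := by ring

lemma Smoothness.integral_inner_mul_line (h : Smoothness f L₁ L₂ L₃) (hL : 0 ≤ L₁) (x a : E d)
    (s : ℝ) : ∫ u, ⟪a, u⟫ * f (x + s • u) ∂(stdGaussian (E d))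
      = s * ∫ u, fderiv ℝ f (x + s • u) a ∂(stdGaussian (E d)) := by
  have hd : ∀ u : E d, HasFDerivAt (fun u => f (x + s • u)) (s • fderiv ℝ f (x + s • u)) u := by
    intro u
    have h1 : HasFDerivAt (fun u : E d => x + s • u) (s • ContinuousLinearMap.id ℝ (E d)) u :=
      ((hasFDerivAt_id u).const_smul s).const_add x
    refine (((h.differentiable _).hasFDerivAt).comp u h1).congr_fderiv ?_
    ext v
    simp
  rw [integral_inner_mul_stdGaussian a hd (h.integrable_line hL x s)
    (h.integrable_inner_mul_line hL x a s), ← integral_const_mul]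
  · simp
  · simpa using (h.integrable_fderiv_line hL x a s).const_mul s

lemma continuous_twoPoint_uncurry (hf : Continuous f) (lam : ℝ) :
    Continuous (fun p : E d × E d => twoPoint f lam p.1 p.2) := by
  unfold twoPoint
  fun_prop

/-- The growth is linear in ‖x‖ and polynomial in ‖u‖, so second moments of the iterates propagate
from one step to the next. -/
lemma Smoothness.norm_twoPoint_le (h : Smoothness f L₁ L₂ L₃) (hL : 0 ≤ L₁) {lam : ℝ}
    (hlam : 0 < lam) (x u : E d) :
    ‖twoPoint f lam x u‖ ≤ ((‖fderiv ℝ f 0‖ + L₁ + L₁ * lam) * (1 + ‖x‖)) * (1 + ‖u‖) ^ 3 := by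
  have hg : ‖fderiv ℝ f x‖ ≤ ‖fderiv ℝ f 0‖ + L₁ * ‖x‖ := by
    have h1 := h.norm_fderiv_sub_le hL x 0
    have h2 := norm_le_norm_add_norm_sub (fderiv ℝ f 0) (fderiv ℝ f x)
    rw [norm_sub_rev] at h2
    rw [sub_zero] at h1
    linarith
  have h1 := h.abs_sub_sub_fderiv_le x (lam • u)
  have h2 := h.abs_sub_sub_fderiv_le x (-(lam • u))
  have h3 := (fderiv ℝ f x).le_opNorm u
  rw [Real.norm_eq_abs] at h3
  rw [norm_neg, ← sub_eq_add_neg] at h2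
  rw [map_neg] at h2
  rw [map_smul, norm_smul, Real.norm_of_nonneg hlam.le, smul_eq_mul] at *
  have h4 : |f (x + lam • u) - f (x - lam • u)|
      ≤ 2 * lam * ((‖fderiv ℝ f x‖ + L₁ * lam) * (1 + ‖u‖) ^ 2) := by
    have e : f (x + lam • u) - f (x - lam • u)
      = (f (x + lam • u) - f x - lam * fderiv ℝ f x u)
        - (f (x - lam • u) - f x - -(lam * fderiv ℝ f x u)) + 2 * lam * fderiv ℝ f x u := by ring
    have h5 : |f (x + lam • u) - f (x - lam • u)|
        ≤ L₁ * (lam * ‖u‖) ^ 2 + 2 * lam * |fderiv ℝ f x u| := by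
      rw [e]
      refine (abs_add_le _ _).trans ?_
      refine add_le_add ((abs_sub _ _).trans (by linarith)) ?_
      rw [abs_mul, abs_of_nonneg (a := 2 * lam) (by positivity)]
    have hu := norm_nonneg u
    have a1 : L₁ * (lam * ‖u‖) ^ 2 ≤ 2 * lam * ((L₁ * lam) * (1 + ‖u‖) ^ 2) := by
      have : 0 ≤ L₁ * lam ^ 2 := by positivity
      nlinarith [mul_nonneg this hu, mul_nonneg this (sq_nonneg ‖u‖)]
    have a2 : 2 * lam * |fderiv ℝ f x u| ≤ 2 * lam * (‖fderiv ℝ f x‖ * (1 + ‖u‖) ^ 2) := by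
      gcongr
      refine h3.trans ?_
      gcongr
      nlinarith
    linarith
  rw [twoPoint, norm_smul, Real.norm_eq_abs, abs_div, abs_of_nonneg (a := 2 * lam) (by positivity)]
  have h6 : |f (x + lam • u) - f (x - lam • u)| / (2 * lam)
      ≤ (‖fderiv ℝ f x‖ + L₁ * lam) * (1 + ‖u‖) ^ 2 := by
    rw [div_le_iff₀ (by positivity)]
    linarith
  have h7 : ‖fderiv ℝ f x‖ + L₁ * lam ≤ (‖fderiv ℝ f 0‖ + L₁ + L₁ * lam) * (1 + ‖x‖) := by
    have q1 : 0 ≤ ‖fderiv ℝ f 0‖ * ‖x‖ := by positivity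
    have q2 : 0 ≤ L₁ * lam * ‖x‖ := by positivity
    nlinarith
  calc _ ≤ ((‖fderiv ℝ f 0‖ + L₁ + L₁ * lam) * (1 + ‖x‖) * (1 + ‖u‖) ^ 2) * (1 + ‖u‖) := by
        gcongr
        · exact h6.trans (by gcongr)
        · linarith
    _ = _ := by ring

lemma Smoothness.integrable_twoPoint (h : Smoothness f L₁ L₂ L₃) (hL : 0 ≤ L₁) {lam : ℝ}
    (hlam : 0 < lam) (x : E d) : Integrable (twoPoint f lam x) (stdGaussian (E d)) := by
  refine ((integrable_one_add_norm_pow 3).const_mul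
    ((‖fderiv ℝ f 0‖ + L₁ + L₁ * lam) * (1 + ‖x‖))).mono'
      ?_ (Filter.Eventually.of_forall (h.norm_twoPoint_le hL hlam x))
  exact ((continuous_twoPoint_uncurry h.continuous lam).comp
    (Continuous.prodMk_right x)).aestronglyMeasurable

lemma Smoothness.integrable_norm_twoPoint_sq (h : Smoothness f L₁ L₂ L₃) (hL : 0 ≤ L₁) {lam : ℝ}
    (hlam : 0 < lam) (x : E d) :
    Integrable (fun u => ‖twoPoint f lam x u‖ ^ 2) (stdGaussian (E d)) := by
  have hc : Continuous (twoPoint f lam x) := (continuous_twoPoint_uncurry h.continuous lam).comp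
    (Continuous.prodMk_right x)
  refine integrable_of_growth (by fun_prop)
    (((‖fderiv ℝ f 0‖ + L₁ + L₁ * lam) * (1 + ‖x‖)) ^ 2) 6 (fun u => ?_)
  rw [abs_of_nonneg (by positivity)]
  calc _ ≤ (((‖fderiv ℝ f 0‖ + L₁ + L₁ * lam) * (1 + ‖x‖)) * (1 + ‖u‖) ^ 3) ^ 2 := by
        gcongr
        exact h.norm_twoPoint_le hL hlam x u
    _ = _ := by ring

lemma integral_fderiv_line_neg (x a : E d) (s : ℝ) :
    ∫ u, fderiv ℝ f (x + (-s) • u) a ∂(stdGaussian (E d))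
      = ∫ u, fderiv ℝ f (x + s • u) a ∂(stdGaussian (E d)) := by
  rw [← integral_comp_neg_stdGaussian]
  simp

lemma smoothed_neg (x : E d) (s : ℝ) : smoothed f (-s) x = smoothed f s x := by
  unfold smoothed
  rw [← integral_comp_neg_stdGaussian]
  simp

/-- Stein is applied to f(x + λu) and f(x - λu), and the two resulting integrals agree because the
Gaussian is even. The right side is the formal derivative of f_λ along `a`; differentiability of f_λ
itself is never needed. -/
lemma Smoothness.inner_meanEstimator (h : Smoothness f L₁ L₂ L₃) (hL : 0 ≤ L₁) {lam : ℝ}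
    (hlam : 0 < lam) (x a : E d) :
    ⟪a, meanEstimator f lam x⟫ = ∫ u, fderiv ℝ f (x + lam • u) a ∂(stdGaussian (E d)) := by
  rw [meanEstimator, ← integral_inner (h.integrable_twoPoint hL hlam x)]
  have e : ∀ u : E d, ⟪a, twoPoint f lam x u⟫
      = (2 * lam)⁻¹ * (⟪a, u⟫ * f (x + lam • u) - ⟪a, u⟫ * f (x + (-lam) • u)) := by
    intro u
    rw [twoPoint, real_inner_smul_right, neg_smul, ← sub_eq_add_neg]
    ring
  simp_rw [e]
  rw [integral_const_mul, integral_sub (h.integrable_inner_mul_line hL x a lam)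
    (h.integrable_inner_mul_line hL x a (-lam)), h.integral_inner_mul_line hL,
    h.integral_inner_mul_line hL, integral_fderiv_line_neg]
  field_simp
  ring

/-- The gradient inequality for f at x + λu and y + λu has the same increment x - y for every u, so
it can be averaged. -/
lemma Smoothness.smoothed_sub_le (h : Smoothness f L₁ L₂ L₃) (hL : 0 ≤ L₁)
    (hc : ConvexOn ℝ Set.univ f) {lam : ℝ} (hlam : 0 < lam) (x y : E d) :
    smoothed f lam x - smoothed f lam y ≤ ⟪x - y, meanEstimator f lam x⟫ := by
  rw [h.inner_meanEstimator hL hlam, smoothed, smoothed,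
    ← integral_sub (h.integrable_line hL x lam) (h.integrable_line hL y lam)]
  refine integral_mono ((h.integrable_line hL x lam).sub (h.integrable_line hL y lam))
    (h.integrable_fderiv_line hL x _ lam) (fun u => ?_)
  have := fderiv_sub_le_of_convex hc h.differentiable (x + lam • u) (y + lam • u)
  rwa [add_sub_add_right_eq_sub] at this

/-- Average the quadratic upper bound for f over a gradient step of length 1/L₁ on f_λ. The value
after the step is kept, since it can be compared with the minimum of F. -/
lemma Smoothness.norm_meanEstimator_sq_le (h : Smoothness f L₁ L₂ L₃) (hL : 0 < L₁) {lam : ℝ}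
    (hlam : 0 < lam) (x : E d) :
    ‖meanEstimator f lam x‖ ^ 2
      ≤ 2 * L₁ * (smoothed f lam x - smoothed f lam (x - L₁⁻¹ • meanEstimator f lam x)) := by
  set G := meanEstimator f lam x with hG
  have h1 : smoothed f lam (x - L₁⁻¹ • G)
      ≤ smoothed f lam x - L₁⁻¹ * ‖G‖ ^ 2 + L₁ / 2 * (L₁⁻¹ * ‖G‖) ^ 2 := by
    have e : ∫ u, fderiv ℝ f (x + lam • u) (-(L₁⁻¹ • G)) ∂(stdGaussian (E d))
        = - (L₁⁻¹ * ‖G‖ ^ 2) := by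
      rw [← h.inner_meanEstimator hL.le hlam, ← hG, inner_neg_left, real_inner_smul_left,
        real_inner_self_eq_norm_sq]
    have i1 := h.integrable_line hL.le x lam
    have i2 := h.integrable_fderiv_line hL.le x (-(L₁⁻¹ • G)) lam
    have i3 : Integrable (fun _ : E d => L₁ / 2 * (L₁⁻¹ * ‖G‖) ^ 2) (stdGaussian (E d)) :=
      integrable_const _
    have h2 : smoothed f lam (x - L₁⁻¹ • G) ≤ ∫ u, (f (x + lam • u)
        + fderiv ℝ f (x + lam • u) (-(L₁⁻¹ • G)) + L₁ / 2 * (L₁⁻¹ * ‖G‖) ^ 2)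
        ∂(stdGaussian (E d)) := by
      refine integral_mono (h.integrable_line hL.le _ lam) ((i1.add i2).add i3) (fun u => ?_)
      have := (abs_le.1 (h.abs_sub_sub_fderiv_le (x + lam • u) (-(L₁⁻¹ • G)))).2
      rw [norm_neg, norm_smul, norm_inv, Real.norm_of_nonneg hL.le,
        show x + lam • u + -(L₁⁻¹ • G) = x - L₁⁻¹ • G + lam • u by module] at this
      simp only
      linarith
    have i12 : Integrable (fun u => f (x + lam • u) + fderiv ℝ f (x + lam • u) (-(L₁⁻¹ • G)))
      (stdGaussian (E d)) := i1.add i2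
    rw [integral_add i12 i3, integral_add i1 i2, e] at h2
    simpa [smoothed, sub_eq_add_neg] using h2
  have e2 : L₁ / 2 * (L₁⁻¹ * ‖G‖) ^ 2 = L₁⁻¹ * ‖G‖ ^ 2 / 2 := by
    field_simp
  rw [e2] at h1
  have h3 : L₁⁻¹ * ‖G‖ ^ 2 / 2 ≤ smoothed f lam x - smoothed f lam (x - L₁⁻¹ • G) := by linarith
  calc ‖G‖ ^ 2 = 2 * L₁ * (L₁⁻¹ * ‖G‖ ^ 2 / 2) := by field_simp
    _ ≤ _ := by gcongr

lemma inner_single_single (i j : Fin d) :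
    ⟪(EuclideanSpace.single i 1 : E d), EuclideanSpace.single j 1⟫ = if i = j then 1 else 0 := by
  simp [EuclideanSpace.inner_single_left]

lemma integrable_iteratedFDeriv_two (f : E d → ℝ) (x : E d) :
    Integrable (fun u => iteratedFDeriv ℝ 2 f x (fun _ => u)) (stdGaussian (E d)) := by
  refine integrable_of_growth ?_ ‖iteratedFDeriv ℝ 2 f x‖ 2 (fun u => ?_)
  · exact (iteratedFDeriv ℝ 2 f x).cont.comp (by fun_prop)
  · have := (iteratedFDeriv ℝ 2 f x).le_opNorm (fun _ => u)
    rw [Real.norm_eq_abs] at this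
    refine this.trans ?_
    simp only [Finset.prod_const, Finset.card_univ, Fintype.card_fin]
    gcongr
    linarith

lemma integral_iteratedFDeriv_two (f : E d → ℝ) (x : E d) :
    ∫ u, iteratedFDeriv ℝ 2 f x (fun _ => u) ∂(stdGaussian (E d)) = trHess f x := by
  have hi : ∀ i j : Fin d, Integrable (fun u : E d => (⟪(EuclideanSpace.single i 1 : E d), u⟫ *
      ⟪(EuclideanSpace.single j 1 : E d), u⟫) * hessian f x i j) (stdGaussian (E d)) := by
    intro i j
    refine Integrable.mul_const (integrable_of_growth (by fun_prop) 1 2 (fun u => ?_)) _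
    have h1 := abs_inner_le_mul_one_add (EuclideanSpace.single i 1 : E d) u
    have h2 := abs_inner_le_mul_one_add (EuclideanSpace.single j 1 : E d) u
    simp only [PiLp.norm_single, norm_one, one_mul] at h1 h2
    rw [abs_mul, one_mul, sq]
    gcongr
  simp_rw [iteratedFDeriv_two_eq_sum]
  rw [integral_finsetSum _ (fun i _ => integrable_finsetSum _ fun j _ => hi i j)]
  simp_rw [fun i => integral_finsetSum Finset.univ (fun j _ => hi i j)]
  simp_rw [integral_mul_const, integral_inner_mul_inner, inner_single_single]
  simp [trHess, Matrix.trace]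

/-- Since f_λ is even in λ, twice the difference is the mean of the second-difference error, at most
L₃λ⁴‖u‖⁴/12, and 𝔼‖u‖⁴ = d(d+2). -/
lemma Smoothness.abs_smoothed_sub_regLoss_le (h : Smoothness f L₁ L₂ L₃) (hL : 0 ≤ L₁) {lam : ℝ}
    (hlam : 0 < lam) (x : E d) :
    |smoothed f lam x - regLoss f lam x| ≤ L₃ * lam ^ 4 * ((d : ℝ) * (d + 2)) / 24 := by
  have i1 := h.integrable_line hL x lam
  have i2 := h.integrable_line hL x (-lam)
  have i3 : Integrable (fun _ : E d => 2 * f x) (stdGaussian (E d)) := integrable_const _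
  have i4 := (integrable_iteratedFDeriv_two f x).const_mul (lam ^ 2)
  have e : ∫ u, (f (x + lam • u) + f (x + (-lam) • u) - 2 * f x
      - lam ^ 2 * iteratedFDeriv ℝ 2 f x (fun _ => u)) ∂(stdGaussian (E d))
      = 2 * (smoothed f lam x - regLoss f lam x) := by
    have i12 : Integrable (fun u => f (x + lam • u) + f (x + (-lam) • u)) (stdGaussian (E d)) :=
      i1.add i2
    have i123 : Integrable (fun u => f (x + lam • u) + f (x + (-lam) • u) - 2 * f x)
      (stdGaussian (E d)) := i12.sub i3
    rw [integral_sub i123 i4, integral_sub i12 i3, integral_add i1 i2,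
      integral_const_mul (lam ^ 2), integral_iteratedFDeriv_two]
    have := smoothed_neg (f := f) x lam
    unfold smoothed at this
    rw [this, regLoss, smoothed]
    simp
    ring
  have hb : |2 * (smoothed f lam x - regLoss f lam x)|
      ≤ ∫ u, L₃ / 12 * lam ^ 4 * (‖u‖ ^ 2) ^ 2 ∂(stdGaussian (E d)) := by
    rw [← e, ← Real.norm_eq_abs]
    refine norm_integral_le_of_norm_le ((integrable_norm_sq_pow 2).const_mul _)
      (Filter.Eventually.of_forall fun u => ?_)
    have := h.abs_second_difference_le x u hlam.le
    rw [Real.norm_eq_abs, neg_smul, ← sub_eq_add_neg]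
    refine this.trans (le_of_eq (by ring))
  rw [integral_const_mul, integral_norm_pow_four, abs_mul, abs_of_pos (by norm_num : (0:ℝ) < 2),
    finrank_euclideanSpace, Fintype.card_fin] at hb
  linarith

/-- With g = ∇f(x), the difference quotient is ⟪g, u⟫ plus an error of size L₂λ²‖u‖³/6. The linear
part has second moment (d+2)‖g‖², and g is then replaced by G at the cost of ‖g - G‖². -/
lemma Smoothness.integral_norm_twoPoint_sq_le (h : Smoothness f L₁ L₂ L₃) (hL : 0 ≤ L₁) {lam : ℝ}
    (hlam : 0 < lam) (x : E d) :
    ∫ u, ‖twoPoint f lam x u‖ ^ 2 ∂(stdGaussian (E d))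
      ≤ 4 * ((d : ℝ) + 2) * ‖meanEstimator f lam x‖ ^ 2 + L₂ ^ 2 * lam ^ 4 * ((d : ℝ) + 6) ^ 4 / 6
      := by
  set G := meanEstimator f lam x with hG
  set g : E d := (InnerProductSpace.toDual ℝ (E d)).symm (fderiv ℝ f x) with hg
  have hgi : ∀ u : E d, ⟪g, u⟫ = fderiv ℝ f x u := fun u => by simp [hg]
  set D : E d → ℝ := fun u => (f (x + lam • u) - f (x - lam • u)) / (2 * lam) with hD
  have hDc : Continuous D := by
    have := h.continuous
    simp only [hD]
    fun_prop
  have hr : ∀ u, |D u - ⟪g, u⟫| ≤ L₂ * lam ^ 2 / 6 * ‖u‖ ^ 3 := by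
    intro u
    have h1 := h.abs_central_difference_le x u hlam.le
    have h2 : D u - ⟪g, u⟫
        = (f (x + lam • u) - f (x - lam • u) - 2 * lam * fderiv ℝ f x u) / (2 * lam) := by
      rw [hgi, hD]
      field_simp
    rw [h2, abs_div, abs_of_pos (a := 2 * lam) (by positivity), div_le_iff₀ (by positivity)]
    refine h1.trans (le_of_eq (by ring))
  have hr2 : ∀ u, (D u - ⟪g, u⟫) ^ 2 ≤ L₂ ^ 2 * lam ^ 4 / 36 * (‖u‖ ^ 2) ^ 3 := by
    intro u
    rw [← sq_abs]
    calc _ ≤ (L₂ * lam ^ 2 / 6 * ‖u‖ ^ 3) ^ 2 := by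
          have := hr u
          gcongr
      _ = _ := by ring
  have hI6 := (integrable_norm_sq_pow (V := E d) 3).const_mul (L₂ ^ 2 * lam ^ 4 / 36)
  have hI8 := (integrable_norm_sq_pow (V := E d) 4).const_mul (L₂ ^ 2 * lam ^ 4 / 18)
  have hfin : (Module.finrank ℝ (E d) : ℝ) = d := by simp
  -- With v = g - G, ‖v‖² is the mean of ⟪v, u⟫ times minus the quotient error. Young's inequality
  -- produces ‖v‖²/2, which is absorbed on the left, and a sixth moment.
  have hv : ‖g - G‖ ^ 2 ≤ L₂ ^ 2 * lam ^ 4 / 36 * ((d : ℝ) * (d + 2) * (d + 4)) := by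
    set v := g - G with hv
    have hIg : Integrable (fun u : E d => ⟪v, u⟫ * ⟪g, u⟫) (stdGaussian (E d)) := by
      refine integrable_of_growth (by fun_prop) (‖v‖ * ‖g‖) 2 (fun u => ?_)
      rw [abs_mul]
      calc _ ≤ (‖v‖ * (1 + ‖u‖)) * (‖g‖ * (1 + ‖u‖)) := by
            gcongr <;> exact abs_inner_le_mul_one_add _ _
        _ = _ := by ring
    have hID := (h.integrable_twoPoint hL hlam x).const_inner (𝕜 := ℝ) v
    have e1 : ‖v‖ ^ 2 = ∫ u, (⟪v, u⟫ * ⟪g, u⟫ - ⟪v, twoPoint f lam x u⟫)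
        ∂(stdGaussian (E d)) := by
      rw [integral_sub hIg hID, integral_inner_mul_inner,
        integral_inner (h.integrable_twoPoint hL hlam x), ← real_inner_self_eq_norm_sq]
      conv_lhs => rw [hv, inner_sub_right, ← hv]
      rfl
    have e2 : ‖v‖ ^ 2 ≤ ∫ u, (1 / 2 * ⟪v, u⟫ ^ 2
        + 1 / 2 * (L₂ ^ 2 * lam ^ 4 / 36 * (‖u‖ ^ 2) ^ 3)) ∂(stdGaussian (E d)) := by
      rw [e1]
      refine integral_mono (hIg.sub hID)
        (((integrable_inner_sq v).const_mul _).add (hI6.const_mul _)) (fun u => ?_)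
      have : ⟪v, twoPoint f lam x u⟫ = D u * ⟪v, u⟫ := by
        rw [twoPoint, real_inner_smul_right]
      simp only [this]
      nlinarith [hr2 u, sq_nonneg (⟪v, u⟫ + (D u - ⟪g, u⟫))]
    rw [integral_add ((integrable_inner_sq v).const_mul _) (hI6.const_mul _), integral_const_mul,
      integral_const_mul, integral_const_mul, integral_inner_sq, integral_norm_pow_six, hfin] at e2
    linarith
  have hmain : ∫ u, ‖twoPoint f lam x u‖ ^ 2 ∂(stdGaussian (E d))
      ≤ ∫ u, (2 * (⟪g, u⟫ ^ 2 * ‖u‖ ^ 2) + L₂ ^ 2 * lam ^ 4 / 18 * (‖u‖ ^ 2) ^ 4)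
        ∂(stdGaussian (E d)) := by
    refine integral_mono (h.integrable_norm_twoPoint_sq hL hlam x)
      (((integrable_inner_sq_mul_norm_sq g).const_mul _).add hI8) (fun u => ?_)
    have e : ‖twoPoint f lam x u‖ ^ 2 = D u ^ 2 * ‖u‖ ^ 2 := by
      rw [twoPoint, norm_smul, mul_pow, Real.norm_eq_abs, sq_abs]
    simp only [e]
    have h1 : D u ^ 2 ≤ 2 * ⟪g, u⟫ ^ 2 + 2 * (L₂ ^ 2 * lam ^ 4 / 36 * (‖u‖ ^ 2) ^ 3) := by
      nlinarith [hr2 u, sq_nonneg (⟪g, u⟫ - (D u - ⟪g, u⟫))]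
    calc _ ≤ (2 * ⟪g, u⟫ ^ 2 + 2 * (L₂ ^ 2 * lam ^ 4 / 36 * (‖u‖ ^ 2) ^ 3)) * ‖u‖ ^ 2 := by
          gcongr
      _ = _ := by ring
  rw [integral_add ((integrable_inner_sq_mul_norm_sq g).const_mul _) hI8, integral_const_mul,
    integral_const_mul, integral_inner_sq_mul_norm_sq, integral_norm_pow_eight, hfin] at hmain
  have hgG : ‖g‖ ^ 2 ≤ 2 * ‖G‖ ^ 2 + 2 * ‖g - G‖ ^ 2 := by
    have h1 : ‖g‖ ≤ ‖G‖ + ‖g - G‖ := by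
      simpa using norm_add_le G (g - G)
    nlinarith [norm_nonneg g, sq_nonneg (‖G‖ - ‖g - G‖)]
  have hd0 : (0 : ℝ) ≤ d := Nat.cast_nonneg d
  have hK : 0 ≤ L₂ ^ 2 * lam ^ 4 := by positivity
  have h2 : ((d : ℝ) + 2) * ‖g‖ ^ 2 ≤ (d + 2) * (2 * ‖G‖ ^ 2
      + 2 * (L₂ ^ 2 * lam ^ 4 / 36 * ((d : ℝ) * (d + 2) * (d + 4)))) := by
    gcongr
    linarith
  -- The two error terms carry factors 1/9 and 1/18; bounding both polynomials by (d+6)⁴ gives the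
  -- final 1/6.
  have h3 : ((d : ℝ) + 2) * (d * (d + 2) * (d + 4)) ≤ (d + 6) ^ 4 := by
    calc _ ≤ ((d : ℝ) + 6) * ((d + 6) * (d + 6) * (d + 6)) := by gcongr <;> linarith
      _ = _ := by ring
  have h4 : (d : ℝ) * (d + 2) * (d + 4) * (d + 6) ≤ (d + 6) ^ 4 := by
    calc _ ≤ ((d : ℝ) + 6) * (d + 6) * (d + 6) * (d + 6) := by gcongr <;> linarith
      _ = _ := by ring
  have h5 := mul_le_mul_of_nonneg_left h3 hK
  have h6 := mul_le_mul_of_nonneg_left h4 hK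
  nlinarith

lemma integral_norm_step_sq_le (h : Smoothness f L₁ L₂ L₃) (hL : 0 < L₁)
    (hc : ConvexOn ℝ Set.univ f) {lam : ℝ} (hlam : 0 < lam) {xF : E d}
    (hF : xF ∈ minimizers (regLoss f lam)) (x : E d) :
    ∫ u, ‖x - stepsize d L₁ • twoPoint f lam x u - xF‖ ^ 2 ∂(stdGaussian (E d))
      ≤ ‖x - xF‖ ^ 2 - stepsize d L₁ * (regLoss f lam x - regLoss f lam xF)
        + stepsize d L₁ * (L₃ * lam ^ 4 * ((d : ℝ) * (d + 2)) / 6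
          + L₂ ^ 2 * lam ^ 4 * ((d : ℝ) + 6) ^ 3 / (48 * L₁)) := by
  set η := stepsize d L₁ with hη
  have hηpos : 0 < η := by rw [hη, stepsize]; positivity
  have hηL : η * (8 * ((d : ℝ) + 6) * L₁) = 1 := by
    rw [hη, stepsize]
    field_simp
  set G := meanEstimator f lam x with hG
  have e : ∀ u, ‖x - η • twoPoint f lam x u - xF‖ ^ 2
      = ‖x - xF‖ ^ 2 - 2 * η * ⟪x - xF, twoPoint f lam x u⟫ + η ^ 2 * ‖twoPoint f lam x u‖ ^ 2 := by
    intro u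
    rw [show x - η • twoPoint f lam x u - xF = (x - xF) - η • twoPoint f lam x u by abel,
      norm_sub_sq_real, real_inner_smul_right, norm_smul, mul_pow, Real.norm_eq_abs, sq_abs]
    ring
  have i1 : Integrable (fun _ : E d => ‖x - xF‖ ^ 2) (stdGaussian (E d)) := integrable_const _
  have i2 := ((h.integrable_twoPoint hL.le hlam x).const_inner (𝕜 := ℝ) (x - xF)).const_mul (2 * η)
  have i12 : Integrable (fun u => ‖x - xF‖ ^ 2 - 2 * η * ⟪x - xF, twoPoint f lam x u⟫)
    (stdGaussian (E d)) := i1.sub i2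
  have i3 := (h.integrable_norm_twoPoint_sq hL.le hlam x).const_mul (η ^ 2)
  have hint : ∫ u, ‖x - η • twoPoint f lam x u - xF‖ ^ 2 ∂(stdGaussian (E d))
      = ‖x - xF‖ ^ 2 - 2 * η * ⟪x - xF, G⟫
        + η ^ 2 * ∫ u, ‖twoPoint f lam x u‖ ^ 2 ∂(stdGaussian (E d)) := by
    simp_rw [e]
    rw [integral_add i12 i3, integral_sub i1 i2, integral_const_mul, integral_const_mul,
      integral_inner (h.integrable_twoPoint hL.le hlam x)]
    simp [hG, meanEstimator]
  have c1 := h.smoothed_sub_le hL.le hc hlam x xF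
  have c2 := h.norm_meanEstimator_sq_le hL hlam x
  have c3 := h.integral_norm_twoPoint_sq_le hL.le hlam x
  have a1 := abs_le.1 (h.abs_smoothed_sub_regLoss_le hL.le hlam x)
  have a2 := abs_le.1 (h.abs_smoothed_sub_regLoss_le hL.le hlam xF)
  have a3 := abs_le.1 (h.abs_smoothed_sub_regLoss_le hL.le hlam (x - L₁⁻¹ • G))
  have a4 := hF (x - L₁⁻¹ • G)
  rw [← hG] at c1 c2 c3
  set e0 := L₃ * lam ^ 4 * ((d : ℝ) * (d + 2)) / 24 with he0
  set K := L₂ ^ 2 * lam ^ 4 * ((d : ℝ) + 6) ^ 3 with hK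
  -- The value of f_λ after the gradient step is at least F(x_F) - e0, hence at least f_λ(x_F) - 2
  -- e0.
  have c4 : ‖G‖ ^ 2 ≤ 2 * L₁ * (smoothed f lam x - smoothed f lam xF + 2 * e0) := by
    refine c2.trans ?_
    gcongr
    linarith
  have hd0 : (0 : ℝ) ≤ d := Nat.cast_nonneg d
  -- Enlarging d + 2 to d + 6 makes the factor η · 8(d+6)L₁ exactly 1, so the second moment uses one
  -- of the two copies of η times the f_λ-gap.
  have c5 : η ^ 2 * ∫ u, ‖twoPoint f lam x u‖ ^ 2 ∂(stdGaussian (E d))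
      ≤ η * (smoothed f lam x - smoothed f lam xF + 2 * e0) + η * (K / (48 * L₁)) := by
    calc _ ≤ η ^ 2 * (4 * ((d : ℝ) + 6) * (2 * L₁ * (smoothed f lam x - smoothed f lam xF + 2 * e0))
          + L₂ ^ 2 * lam ^ 4 * ((d : ℝ) + 6) ^ 4 / 6) := by
          gcongr
          refine c3.trans ?_
          gcongr
          norm_num
      _ = η * (η * (8 * ((d : ℝ) + 6) * L₁)) * (smoothed f lam x - smoothed f lam xF + 2 * e0)
          + η * (η * (8 * ((d : ℝ) + 6) * L₁)) * (K / (48 * L₁)) := by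
          rw [hK]
          field_simp
          ring
      _ = _ := by rw [hηL]; ring
  rw [hint]
  have c6 : η * (smoothed f lam x - smoothed f lam xF) ≤ η * ⟪x - xF, G⟫ := by gcongr
  have c7 : η * (regLoss f lam x - regLoss f lam xF - 2 * e0)
      ≤ η * (smoothed f lam x - smoothed f lam xF) :=
    mul_le_mul_of_nonneg_left (by linarith) hηpos.le
  have c8 : L₃ * lam ^ 4 * ((d : ℝ) * (d + 2)) / 6 = 4 * e0 := by rw [he0]; ring
  rw [c8]
  linarith

end

/-! ### The descent on the product space, and its transfer to an arbitrary run. -/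

section

variable {d : ℕ} {f : E d → ℝ} {L₁ L₂ L₃ : ℝ}

/-- The iterates of the descent as a function of the directions. -/
noncomputable def descent (f : E d → ℝ) (η lam : ℝ) (x₀ : E d) {T : ℕ} (u : Fin T → E d) : ℕ → E d
  | 0 => x₀
  | t + 1 => if h : t < T then descent f η lam x₀ u t
      - η • twoPoint f lam (descent f η lam x₀ u t) (u ⟨t, h⟩) else descent f η lam x₀ u t

lemma descent_succ (f : E d → ℝ) (η lam : ℝ) (x₀ : E d) {T : ℕ} (u : Fin T → E d) (t : Fin T) :
    descent f η lam x₀ u (t + 1) = descent f η lam x₀ u t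
      - η • twoPoint f lam (descent f η lam x₀ u t) (u t) := by
  simp [descent]

lemma descent_congr (f : E d → ℝ) (η lam : ℝ) (x₀ : E d) {T : ℕ} {u v : Fin T → E d} {t : ℕ}
    (h : ∀ i : Fin T, (i : ℕ) < t → u i = v i) :
    descent f η lam x₀ u t = descent f η lam x₀ v t := by
  induction t with
  | zero => rfl
  | succ t ih =>
    have := ih fun i hi => h i (by omega)
    simp only [descent, this]
    split_ifs with ht
    · rw [h ⟨t, ht⟩ (by simp)]
    · rfl

lemma continuous_descent (hf : Continuous f) (η lam : ℝ) (x₀ : E d) {T : ℕ} (t : ℕ) :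
    Continuous (fun u : Fin T → E d => descent f η lam x₀ u t) := by
  induction t with
  | zero => exact continuous_const
  | succ t ih =>
    by_cases ht : t < T
    · simp only [descent, ht, dif_pos]
      exact ih.sub (((continuous_twoPoint_uncurry hf lam).comp
        (ih.prodMk (continuous_apply (⟨t, ht⟩ : Fin T)))).const_smul η)
    · simpa only [descent, ht, dif_neg, not_false_iff] using ih

/-- The joint law of the directions. -/
noncomputable def directions (d T : ℕ) : Measure (Fin T → E d) :=
  Measure.pi fun _ => stdGaussian (E d)

instance (d T : ℕ) : IsProbabilityMeasure (directions d T) := by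
  unfold directions; infer_instance

lemma map_eval_directions (T : ℕ) (t : Fin T) :
    (directions d T).map (fun u => u t) = stdGaussian (E d) :=
  (measurePreserving_eval (fun _ : Fin T => stdGaussian (E d)) t).map_eq

/-- The iterate at time t only reads directions with index below t, and these are independent of the
direction at t. -/
lemma indepFun_descent (hf : Continuous f) (η lam : ℝ) (x₀ : E d) {T : ℕ} (t : Fin T) :
    IndepFun (fun u : Fin T → E d => descent f η lam x₀ u t) (fun u => u t) (directions d T) := by
  classical
  have h0 : iIndepFun (fun (i : Fin T) (u : Fin T → E d) => u i) (directions d T) :=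
    iIndepFun_pi (X := fun (_ : Fin T) (x : E d) => x) (fun _ => aemeasurable_id')
  -- Unread directions are filled with 0; `descent_congr` shows that this does not change the
  -- iterate.
  set S : Finset (Fin T) := Finset.univ.filter fun i => i < t with hS
  have h1 := h0.indepFun_finset S {t} (by simp [hS]) (fun i => measurable_pi_apply i)
  have hm : Measurable (fun v : S → E d => descent f η lam x₀
      (fun i : Fin T => if h : i ∈ S then v ⟨i, h⟩ else 0) t) := by
    refine (continuous_descent hf η lam x₀ t).measurable.comp (measurable_pi_lambda _ fun i => ?_)
    by_cases h : i ∈ S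
    · simpa only [h, dif_pos] using measurable_pi_apply _
    · simpa only [h, dif_neg, not_false_iff] using measurable_const
  have h2 := h1.comp hm
    (measurable_pi_apply (⟨t, Finset.mem_singleton_self t⟩ : ({t} : Finset (Fin T))))
  have he : (fun u : Fin T → E d => descent f η lam x₀ u t) = (fun v : S → E d => descent f η lam x₀
      (fun i : Fin T => if h : i ∈ S then v ⟨i, h⟩ else 0) t) ∘ fun u (i : S) => u i := by
    ext1 u
    refine descent_congr f η lam x₀ fun i hi => ?_
    have : i ∈ S := by simpa [hS] using hi
    simp [this]
  rw [he]
  exact h2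

lemma Smoothness.integrable_one_add_norm_descent_sq (h : Smoothness f L₁ L₂ L₃) (hL : 0 ≤ L₁)
    {η lam : ℝ} (hη : 0 ≤ η) (hlam : 0 < lam) (x₀ : E d) {T : ℕ} {t : ℕ} (ht : t ≤ T) :
    Integrable (fun u : Fin T → E d => (1 + ‖descent f η lam x₀ u t‖) ^ 2) (directions d T) := by
  induction t with
  | zero => simpa only [descent] using integrable_const ((1 + ‖x₀‖) ^ 2)
  | succ t ih =>
    have ih := ih (by omega)
    set s : Fin T := ⟨t, by omega⟩ with hs
    set K := ‖fderiv ℝ f 0‖ + L₁ + L₁ * lam with hK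
    have hK0 : 0 ≤ K := by positivity
    have hg : Integrable (fun u : Fin T → E d => (1 + ‖u s‖) ^ 6) (directions d T) := by
      have := integrable_one_add_norm_pow (V := E d) 6
      rw [← map_eval_directions T s] at this
      exact this.comp_measurable (measurable_pi_apply s)
    have hind := (indepFun_descent (x₀ := x₀) h.continuous η lam s).comp
      (φ := fun x : E d => (1 + ‖x‖) ^ 2) (ψ := fun x : E d => (1 + ‖x‖) ^ 6)
      (by fun_prop) (by fun_prop)
    have hi := (hind.integrable_mul ih hg).const_mul ((1 + η * K) ^ 2)
    refine hi.mono' ?_ (Filter.Eventually.of_forall fun u => ?_)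
    · have := continuous_descent (x₀ := x₀) h.continuous η lam (T := T) (t + 1)
      exact (by fun_prop : Continuous fun u : Fin T → E d =>
        (1 + ‖descent f η lam x₀ u (t + 1)‖) ^ 2).aestronglyMeasurable
    · rw [Real.norm_of_nonneg (by positivity)]
      have hd := descent_succ f η lam x₀ u s
      simp only [hs] at hd
      have h1 := h.norm_twoPoint_le hL hlam (descent f η lam x₀ u t) (u s)
      rw [← hK] at h1
      have h2 : ‖descent f η lam x₀ u (t + 1)‖ ≤ ‖descent f η lam x₀ u t‖
          + η * (K * (1 + ‖descent f η lam x₀ u t‖) * (1 + ‖u s‖) ^ 3) := by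
        rw [hd]
        refine (norm_sub_le _ _).trans ?_
        rw [norm_smul, Real.norm_of_nonneg hη]
        gcongr
      -- After squaring, the bound is a product of independent integrable factors, so the induction
      -- closes.
      have h3 : 1 + ‖descent f η lam x₀ u (t + 1)‖
          ≤ (1 + η * K) * ((1 + ‖descent f η lam x₀ u t‖) * (1 + ‖u s‖) ^ 3) := by
        have : 1 ≤ (1 + ‖u s‖) ^ 3 := one_le_pow₀ (by linarith [norm_nonneg (u s)])
        nlinarith [norm_nonneg (descent f η lam x₀ u t)]
      calc _ ≤ ((1 + η * K) * ((1 + ‖descent f η lam x₀ u t‖) * (1 + ‖u s‖) ^ 3)) ^ 2 := by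
            gcongr
        _ = _ := by
            simp only [Pi.mul_apply, Function.comp_apply, hs]
            ring

/-- Continuous functions of quadratic growth are integrable along the descent. -/
lemma Smoothness.integrable_descent (h : Smoothness f L₁ L₂ L₃) (hL : 0 ≤ L₁)
    {η lam : ℝ} (hη : 0 ≤ η) (hlam : 0 < lam) (x₀ : E d) {T : ℕ} {t : ℕ} (ht : t ≤ T)
    {φ : E d → ℝ} (hφ : Continuous φ) {C : ℝ} (hC : ∀ x, |φ x| ≤ C * (1 + ‖x‖) ^ 2) :
    Integrable (fun u : Fin T → E d => φ (descent f η lam x₀ u t)) (directions d T) :=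
  ((h.integrable_one_add_norm_descent_sq hL hη hlam x₀ ht).const_mul C).mono'
    (hφ.comp (continuous_descent h.continuous η lam x₀ t)).aestronglyMeasurable
    (Filter.Eventually.of_forall fun _ => hC _)

lemma Smoothness.exists_growth (h : Smoothness f L₁ L₂ L₃) (hL : 0 ≤ L₁) :
    ∃ C, ∀ x, |f x| ≤ C * (1 + ‖x‖) ^ 2 :=
  ⟨_, fun x => by simpa using h.abs_le_growth hL 0 x 1⟩

lemma Smoothness.abs_trHess_le (h : Smoothness f L₁ L₂ L₃) (hL : 0 ≤ L₁)
    (hc : ConvexOn ℝ Set.univ f) (x : E d) : |trHess f x| ≤ d * L₁ * (1 + ‖x‖) ^ 2 := by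
  rw [abs_of_nonneg (trHess_nonneg h.contDiff hc x)]
  refine (h.trHess_le hL x).trans (le_mul_of_one_le_right (by positivity) ?_)
  exact one_le_pow₀ (by linarith [norm_nonneg x])

lemma abs_norm_sub_sq_le (x y : E d) : |‖x - y‖ ^ 2| ≤ (1 + ‖y‖) ^ 2 * (1 + ‖x‖) ^ 2 := by
  rw [abs_of_nonneg (by positivity), ← mul_pow]
  gcongr
  refine (norm_sub_le _ _).trans ?_
  nlinarith [norm_nonneg x, norm_nonneg y, mul_nonneg (norm_nonneg x) (norm_nonneg y)]

/-- The pair (x_t, u_t) has a product law, so Fubini lets the one-step inequality be integrated over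
x_t without conditional expectations. -/
lemma integral_norm_descent_succ_le (h : Smoothness f L₁ L₂ L₃) (hL : 0 < L₁)
    (hc : ConvexOn ℝ Set.univ f) {lam : ℝ} (hlam : 0 < lam) {xF : E d}
    (hF : xF ∈ minimizers (regLoss f lam)) (x₀ : E d) {T : ℕ} (t : Fin T) :
    ∫ u, ‖descent f (stepsize d L₁) lam x₀ u (t + 1) - xF‖ ^ 2 ∂(directions d T)
      ≤ ∫ u, ‖descent f (stepsize d L₁) lam x₀ u t - xF‖ ^ 2 ∂(directions d T)
        - stepsize d L₁ * (∫ u, f (descent f (stepsize d L₁) lam x₀ u t) ∂(directions d T)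
          + lam ^ 2 / 2 * ∫ u, trHess f (descent f (stepsize d L₁) lam x₀ u t) ∂(directions d T)
          - regLoss f lam xF)
        + stepsize d L₁ * (L₃ * lam ^ 4 * ((d : ℝ) * (d + 2)) / 6
          + L₂ ^ 2 * lam ^ 4 * ((d : ℝ) + 6) ^ 3 / (48 * L₁)) := by
  set η := stepsize d L₁ with hη
  have hηpos : 0 ≤ η := by rw [hη, stepsize]; positivity
  set err := L₃ * lam ^ 4 * ((d : ℝ) * (d + 2)) / 6
          + L₂ ^ 2 * lam ^ 4 * ((d : ℝ) + 6) ^ 3 / (48 * L₁) with herr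
  set X := fun u : Fin T → E d => descent f η lam x₀ u t with hX
  have hXc : Continuous X := continuous_descent h.continuous η lam x₀ t
  obtain ⟨C, hC⟩ := h.exists_growth hL.le
  have htl : (t : ℕ) ≤ T := t.2.le
  have i1 : Integrable (fun u => ‖X u - xF‖ ^ 2) (directions d T) :=
    h.integrable_descent hL.le hηpos hlam x₀ htl (φ := fun x => ‖x - xF‖ ^ 2) (by fun_prop)
      (fun x => abs_norm_sub_sq_le x xF)
  have i2 : Integrable (fun u => f (X u)) (directions d T) :=
    h.integrable_descent hL.le hηpos hlam x₀ htl h.continuous hC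
  have i3 : Integrable (fun u => trHess f (X u)) (directions d T) :=
    h.integrable_descent hL.le hηpos hlam x₀ htl (continuous_trHess h.contDiff)
      (h.abs_trHess_le hL.le hc)
  have iR : Integrable (fun u => regLoss f lam (X u)) (directions d T) :=
    i2.add (i3.const_mul (lam ^ 2 / 2))
  have iR' : Integrable (fun u => η * (regLoss f lam (X u) - regLoss f lam xF))
    (directions d T) := (iR.sub (integrable_const _)).const_mul η
  have i4 : Integrable (fun u => ‖X u - xF‖ ^ 2 - η * (regLoss f lam (X u) - regLoss f lam xF))
    (directions d T) := i1.sub iR'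
  have i5 : Integrable (fun u => ‖X u - xF‖ ^ 2 - η * (regLoss f lam (X u) - regLoss f lam xF)
    + η * err) (directions d T) := i4.add (integrable_const _)
  set Φ : E d × E d → ℝ := fun p => ‖p.1 - η • twoPoint f lam p.1 p.2 - xF‖ ^ 2 with hΦ
  have hΦc : Continuous Φ := by
    have := continuous_twoPoint_uncurry h.continuous lam
    simp only [hΦ]
    fun_prop
  have hmap : (directions d T).map (fun u => (X u, u t))
      = ((directions d T).map X).prod (stdGaussian (E d)) := by
    rw [(indepFun_iff_map_prod_eq_prod_map_map hXc.aemeasurable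
      (measurable_pi_apply t).aemeasurable).1 (indepFun_descent h.continuous η lam x₀ t),
      map_eval_directions]
  have hpm : AEMeasurable (fun u : Fin T → E d => (X u, u t)) (directions d T) :=
    (hXc.measurable.prodMk (measurable_pi_apply t)).aemeasurable
  have hstep : ∀ u : Fin T → E d, ‖descent f η lam x₀ u (t + 1) - xF‖ ^ 2 = Φ (X u, u t) := by
    intro u
    rw [descent_succ]
  have iΦ : Integrable Φ (((directions d T).map X).prod (stdGaussian (E d))) := by
    rw [← hmap, integrable_map_measure hΦc.aestronglyMeasurable hpm]
    have := h.integrable_descent hL.le hηpos hlam x₀ (t := t + 1) t.2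
      (φ := fun x => ‖x - xF‖ ^ 2) (by fun_prop) (fun x => abs_norm_sub_sq_le x xF)
    simp only [hstep] at this
    exact this
  have hprob : IsProbabilityMeasure ((directions d T).map X) :=
    Measure.isProbabilityMeasure_map hXc.aemeasurable
  have hregc : Continuous (regLoss f lam) := by
    have h1 := h.continuous
    have h2 := continuous_trHess h.contDiff
    unfold regLoss
    fun_prop
  calc ∫ u, ‖descent f η lam x₀ u (t + 1) - xF‖ ^ 2 ∂(directions d T)
      = ∫ u, Φ (X u, u t) ∂(directions d T) := by simp_rw [hstep]
    _ = ∫ p, Φ p ∂(((directions d T).map X).prod (stdGaussian (E d))) := by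
        rw [← hmap, integral_map hpm hΦc.aestronglyMeasurable]
    _ = ∫ x, ∫ v, Φ (x, v) ∂(stdGaussian (E d)) ∂((directions d T).map X) := integral_prod _ iΦ
    _ ≤ ∫ x, (‖x - xF‖ ^ 2 - η * (regLoss f lam x - regLoss f lam xF) + η * err)
        ∂((directions d T).map X) := by
        refine integral_mono iΦ.integral_prod_left ?_
          (fun x => integral_norm_step_sq_le h hL hc hlam hF x)
        rw [integrable_map_measure (Continuous.aestronglyMeasurable (by fun_prop))
          hXc.aemeasurable]
        exact i5
    _ = ∫ u, (‖X u - xF‖ ^ 2 - η * (regLoss f lam (X u) - regLoss f lam xF) + η * err)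
        ∂(directions d T) := by
        rw [integral_map hXc.aemeasurable (Continuous.aestronglyMeasurable (by fun_prop))]
    _ = _ := by
        rw [integral_add i4 (integrable_const _), integral_sub i1 iR', integral_const_mul,
          integral_sub iR (integrable_const _)]
        simp only [regLoss]
        rw [integral_add i2 (i3.const_mul _), integral_const_mul]
        simp [hX]

/-- The squared distances telescope, and the final one is dropped as nonnegative. -/
lemma sum_integral_descent_le (h : Smoothness f L₁ L₂ L₃) (hL : 0 < L₁)
    (hc : ConvexOn ℝ Set.univ f) {lam : ℝ} (hlam : 0 < lam) {xF : E d}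
    (hF : xF ∈ minimizers (regLoss f lam)) (x₀ : E d) (T : ℕ) :
    stepsize d L₁ * ∑ t : Fin T,
        (∫ u, f (descent f (stepsize d L₁) lam x₀ u t) ∂(directions d T)
          + lam ^ 2 / 2 * ∫ u, trHess f (descent f (stepsize d L₁) lam x₀ u t) ∂(directions d T)
          - regLoss f lam xF)
      ≤ ‖x₀ - xF‖ ^ 2 + T * (stepsize d L₁ * (L₃ * lam ^ 4 * ((d : ℝ) * (d + 2)) / 6
          + L₂ ^ 2 * lam ^ 4 * ((d : ℝ) + 6) ^ 3 / (48 * L₁))) := by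
  set η := stepsize d L₁ with hη
  set err := L₃ * lam ^ 4 * ((d : ℝ) * (d + 2)) / 6
          + L₂ ^ 2 * lam ^ 4 * ((d : ℝ) + 6) ^ 3 / (48 * L₁) with herr
  set q : ℕ → ℝ := fun t => ∫ u, ‖descent f η lam x₀ u t - xF‖ ^ 2 ∂(directions d T) with hq
  have hstep : ∀ t : Fin T, η * (∫ u, f (descent f η lam x₀ u t) ∂(directions d T)
          + lam ^ 2 / 2 * ∫ u, trHess f (descent f η lam x₀ u t) ∂(directions d T)
          - regLoss f lam xF) ≤ (q t - q (t + 1)) + η * err := fun t => by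
    have := integral_norm_descent_succ_le h hL hc hlam hF x₀ t
    simp only [← hη, ← herr] at this
    simp only [hq]
    linarith
  rw [Finset.mul_sum]
  refine (Finset.sum_le_sum fun t _ => hstep t).trans ?_
  rw [Finset.sum_add_distrib, Fin.sum_univ_eq_sum_range (fun t => q t - q (t + 1)),
    Finset.sum_range_sub']
  have h0 : q 0 = ‖x₀ - xF‖ ^ 2 := by simp [hq, descent]
  have hT : 0 ≤ q T := integral_nonneg fun u => by positivity
  simp only [Finset.sum_const, Finset.card_univ, Fintype.card_fin, nsmul_eq_mul]
  linarith

section Run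

variable {Ω : Type*} [MeasurableSpace Ω] {P : Measure Ω} {η lam : ℝ}
  {x₀ : E d} {T : ℕ} {u : Fin T → Ω → E d} {x : ℕ → Ω → E d} {τ : Ω → Fin T}

lemma IsRun.eq_descent (hr : IsRun P f η lam x₀ T u x τ) (ω : Ω) {t : ℕ} (ht : t ≤ T) :
    x t ω = descent f η lam x₀ (fun i => u i ω) t := by
  induction t with
  | zero => exact hr.init ω
  | succ t ih =>
    have h1 := hr.step ⟨t, by omega⟩ ω
    have h2 := descent_succ f η lam x₀ (fun i => u i ω) ⟨t, by omega⟩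
    simp only at h1 h2
    rw [h1, h2, ih (by omega)]

variable [IsProbabilityMeasure P]

lemma IsRun.map_directions (hr : IsRun P f η lam x₀ T u x τ) :
    P.map (fun ω t => u t ω) = directions d T := by
  rw [(iIndepFun_iff_map_fun_eq_pi_map fun t => (hr.gaussian t).aemeasurable).1 hr.indep]
  unfold directions
  congr 1
  ext1 t
  exact (hr.gaussian t).map_eq

lemma IsRun.map_index_directions (hr : IsRun P f η lam x₀ T u x τ) :
    P.map (fun ω => (τ ω, fun t => u t ω))
      = (uniformOn (Set.univ : Set (Fin T))).prod (directions d T) := by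
  rw [(indepFun_iff_map_prod_eq_prod_map_map hr.uniform.aemeasurable
    (aemeasurable_pi_lambda _ fun t => (hr.gaussian t).aemeasurable)).1 hr.indep_index,
    hr.uniform.map_eq, hr.map_directions]

/-- The index and the directions have a product law. Only finitely many index values occur, so
integrability is checked at each t, and each t has weight 1/T. -/
lemma IsRun.integrable_and_integral (hr : IsRun P f η lam x₀ T u x τ) (hf : Continuous f)
    {φ : E d → ℝ} (hφ : Continuous φ)
    (hi : ∀ t : Fin T, Integrable (fun v : Fin T → E d => φ (descent f η lam x₀ v t))
      (directions d T)) :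
    Integrable (fun ω => φ (x (τ ω) ω)) P ∧
      ∫ ω, φ (x (τ ω) ω) ∂P
        = (T : ℝ)⁻¹ * ∑ t : Fin T, ∫ v, φ (descent f η lam x₀ v t) ∂(directions d T) := by
  have hne : Nonempty Ω := nonempty_of_isProbabilityMeasure P
  have : Nonempty (Fin T) := hne.map τ
  set Ψ : Fin T × (Fin T → E d) → ℝ := fun p => φ (descent f η lam x₀ p.2 p.1) with hΨ
  have e : ∀ ω, φ (x (τ ω) ω) = Ψ (τ ω, fun t => u t ω) := fun ω => by
    rw [hr.eq_descent ω (τ ω).2.le]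
  have hm : Measurable Ψ := measurable_from_prod_countable_right fun t =>
    (hφ.comp (continuous_descent hf η lam x₀ t)).measurable
  have hpm : AEMeasurable (fun ω => (τ ω, fun t => u t ω)) P :=
    hr.uniform.aemeasurable.prodMk (aemeasurable_pi_lambda _ fun t => (hr.gaussian t).aemeasurable)
  have hI : Integrable Ψ ((uniformOn (Set.univ : Set (Fin T))).prod (directions d T)) := by
    rw [integrable_prod_iff hm.aestronglyMeasurable]
    exact ⟨Filter.Eventually.of_forall hi, Integrable.of_finite⟩
  simp_rw [e]
  constructor
  · rw [← hr.map_index_directions, integrable_map_measure hm.aestronglyMeasurable hpm] at hI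
    exact hI
  · rw [← integral_map (f := Ψ) hpm hm.aestronglyMeasurable, hr.map_index_directions,
      integral_prod _ hI, integral_fintype Integrable.of_finite, Finset.mul_sum]
    refine Finset.sum_congr rfl fun t _ => ?_
    congr 1
    rw [measureReal_def, uniformOn_univ]
    simp

end Run

end

/-! ### Choice of the parameters and the final bounds. -/

section

variable {d : ℕ} {f : E d → ℝ} {L₁ L₂ L₃ : ℝ}

lemma smoothingSq_le_third (d : ℕ) (L₁ L₂ L₃ ε : ℝ) :
    smoothingSq d L₁ L₂ L₃ ε ≤ 3 * ε / (4 * L₃ * ((d : ℝ) + 4) ^ 2) :=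
  (min_le_right _ _).trans (min_le_left _ _)

lemma smoothingSq_le_fourth (d : ℕ) (L₁ L₂ L₃ ε : ℝ) :
    smoothingSq d L₁ L₂ L₃ ε ≤ 3 * L₁ * ε / (L₂ ^ 2 * ((d : ℝ) + 6) ^ 3) :=
  (min_le_right _ _).trans (min_le_right _ _)

/-- The lower bound on the number of iterations is at least `64 (d + 6) L₁ R² / (ε λ²)`. -/
lemma le_iterBound_mul_smoothingSq (hd : 1 ≤ d) (hL₁ : 0 < L₁) (hL₂ : 0 < L₂) (hL₃ : 0 < L₃)
    {ε : ℝ} (hε : 0 < ε) (R : ℝ) :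
    64 * ((d : ℝ) + 6) * L₁ * R ^ 2 / ε ≤ iterBound d L₁ L₂ L₃ ε R * smoothingSq d L₁ L₂ L₃ ε := by
  have hdp : (0 : ℝ) < d := by exact_mod_cast hd
  rw [iterBound, mul_assoc (64 * ((d : ℝ) + 6) * L₁ * R ^ 2 / ε)]
  refine le_mul_of_one_le_right (by positivity) ?_
  have e1 : (d : ℝ) ^ (3 / 2 : ℝ) * L₃ / (√2 * L₁)
      = (√2 * L₁ / ((d : ℝ) ^ (3 / 2 : ℝ) * L₃))⁻¹ := by rw [inv_div]
  have e2 : L₃ * ((d : ℝ) + 10) ^ 2 / (12 * √(L₁ * ε))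
      = (12 * √(L₁ * ε) / (L₃ * ((d : ℝ) + 10) ^ 2))⁻¹ := by rw [inv_div]
  have e3 : 4 * L₃ * ((d : ℝ) + 4) ^ 2 / (3 * ε)
      = (3 * ε / (4 * L₃ * ((d : ℝ) + 4) ^ 2))⁻¹ := by rw [inv_div]
  have e4 : L₂ ^ 2 * ((d : ℝ) + 6) ^ 3 / (3 * L₁ * ε)
      = (3 * L₁ * ε / (L₂ ^ 2 * ((d : ℝ) + 6) ^ 3))⁻¹ := by rw [inv_div]
  have p1 : 0 < √2 * L₁ / ((d : ℝ) ^ (3 / 2 : ℝ) * L₃) := by positivity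
  have p2 : 0 < 12 * √(L₁ * ε) / (L₃ * ((d : ℝ) + 10) ^ 2) := by positivity
  have p3 : 0 < 3 * ε / (4 * L₃ * ((d : ℝ) + 4) ^ 2) := by positivity
  have p4 : 0 < 3 * L₁ * ε / (L₂ ^ 2 * ((d : ℝ) + 6) ^ 3) := by positivity
  rw [e1, e2, e3, e4, smoothingSq]
  generalize √2 * L₁ / ((d : ℝ) ^ (3 / 2 : ℝ) * L₃) = a at *
  generalize 12 * √(L₁ * ε) / (L₃ * ((d : ℝ) + 10) ^ 2) = b at *
  generalize 3 * ε / (4 * L₃ * ((d : ℝ) + 4) ^ 2) = c at *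
  generalize 3 * L₁ * ε / (L₂ ^ 2 * ((d : ℝ) + 6) ^ 3) = e at *
  -- The maximum contains the reciprocal of whichever entry attains the minimum.
  have key : ∀ y : ℝ, 0 < y → y⁻¹ ≤ max (max a⁻¹ b⁻¹) (max c⁻¹ e⁻¹) →
      1 ≤ max (max a⁻¹ b⁻¹) (max c⁻¹ e⁻¹) * y := fun y hy hm => by
    rw [← inv_mul_cancel₀ hy.ne']
    gcongr
  rcases min_choice (min a b) (min c e) with h | h <;> rw [h]
  · rcases min_choice a b with h | h <;> rw [h]
    · exact key a p1 (by simp)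
    · exact key b p2 (by simp)
  · rcases min_choice c e with h | h <;> rw [h]
    · exact key c p3 (by simp)
    · exact key e p4 (by simp)

/-- One factor λ² of each λ⁴ is spent: the third entry of the minimum turns the L₃ term into λ²ε/8,
the fourth turns the L₂ term into λ²ε/16. -/
lemma err_le (hL₁ : 0 < L₁) (hL₂ : 0 < L₂) (hL₃ : 0 < L₃) {ε lam : ℝ}
    (hlam : lam ^ 2 = smoothingSq d L₁ L₂ L₃ ε) :
    L₃ * lam ^ 4 * ((d : ℝ) * (d + 2)) / 6 + L₂ ^ 2 * lam ^ 4 * ((d : ℝ) + 6) ^ 3 / (48 * L₁)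
      ≤ 3 / 16 * (lam ^ 2 * ε) := by
  have hd0 : (0 : ℝ) ≤ d := Nat.cast_nonneg d
  have h3 := smoothingSq_le_third d L₁ L₂ L₃ ε
  have h4 := smoothingSq_le_fourth d L₁ L₂ L₃ ε
  rw [← hlam, le_div_iff₀ (by positivity)] at h3 h4
  have a1 : L₃ * lam ^ 4 * ((d : ℝ) * (d + 2)) / 6 ≤ lam ^ 2 * ε / 8 := by
    calc _ ≤ L₃ * lam ^ 4 * ((d + 4) * (d + 4)) / 6 := by gcongr <;> linarith
      _ = lam ^ 2 * (lam ^ 2 * (4 * L₃ * ((d : ℝ) + 4) ^ 2)) / 24 := by ring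
      _ ≤ lam ^ 2 * (3 * ε) / 24 := by gcongr
      _ = _ := by ring
  have a2 : L₂ ^ 2 * lam ^ 4 * ((d : ℝ) + 6) ^ 3 / (48 * L₁) ≤ lam ^ 2 * ε / 16 := by
    calc _ = lam ^ 2 * (lam ^ 2 * (L₂ ^ 2 * ((d : ℝ) + 6) ^ 3)) / (48 * L₁) := by ring
      _ ≤ lam ^ 2 * (3 * L₁ * ε) / (48 * L₁) := by gcongr
      _ = _ := by field_simp; ring
  linarith

/-- The guarantee on the value and on the trace of the Hessian at the output of a run. -/
theorem IsRun.isApproxFlatMinInExpectation (hL₁ : 0 < L₁) (hL₂ : 0 < L₂) (hL₃ : 0 < L₃)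
    {ε lam : ℝ} {x₀ xF : E d} {T : ℕ} (hd : 1 ≤ d) (h : Smoothness f L₁ L₂ L₃)
    (hc : ConvexOn ℝ Set.univ f) (hne : (minimizers f).Nonempty) (hε : 0 < ε) (hlam : 0 < lam)
    (hlam2 : lam ^ 2 = smoothingSq d L₁ L₂ L₃ ε) (hF : xF ∈ minimizers (regLoss f lam))
    (hT1 : 1 ≤ T) (hT : iterBound d L₁ L₂ L₃ ε ‖x₀ - xF‖ ≤ T)
    {Ω : Type*} [MeasurableSpace Ω] {P : Measure Ω} [IsProbabilityMeasure P]
    {u : Fin T → Ω → E d} {x : ℕ → Ω → E d} {τ : Ω → Fin T}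
    (hr : IsRun P f (stepsize d L₁) lam x₀ T u x τ) :
    IsApproxFlatMinInExpectation P f (fun ω => x (τ ω) ω)
      (3 * L₁ ^ 2 * ε / (2 * L₂ ^ 2 * ((d : ℝ) + 6) ^ 2) * (1 + ε / (L₁ * ((d : ℝ) + 6)))) ε := by
  have hηpos : 0 < stepsize d L₁ := by rw [stepsize]; positivity
  have hTpos : (0 : ℝ) < T := by exact_mod_cast hT1
  obtain ⟨C, hC⟩ := h.exists_growth hL₁.le
  obtain ⟨if1, ef⟩ := hr.integrable_and_integral h.continuous h.continuous
    (fun t => h.integrable_descent hL₁.le hηpos.le hlam x₀ t.2.le h.continuous hC)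
  obtain ⟨it1, et⟩ := hr.integrable_and_integral h.continuous (continuous_trHess h.contDiff)
    (fun t => h.integrable_descent hL₁.le hηpos.le hlam x₀ t.2.le (continuous_trHess h.contDiff)
      (h.abs_trHess_le hL₁.le hc))
  have hsum := sum_integral_descent_le h hL₁ hc hlam hF x₀ T
  set A := ∫ ω, f (x (τ ω) ω) ∂P with hA
  set B := ∫ ω, trHess f (x (τ ω) ω) ∂P with hB
  -- The initial distance contributes λ²ε/8 and the error 3λ²ε/16; their sum 5λ²ε/16 is below λ²ε/2.
  have hgap : A + lam ^ 2 / 2 * B - regLoss f lam xF ≤ lam ^ 2 * ε / 2 := by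
    rw [Finset.sum_sub_distrib, Finset.sum_add_distrib, ← Finset.mul_sum] at hsum
    have eA := congrArg (fun y => (T : ℝ) * y) ef
    have eB := congrArg (fun y => (T : ℝ) * y) et
    simp only [mul_inv_cancel_left₀ hTpos.ne'] at eA eB
    rw [← eA, ← eB, Finset.sum_const, Finset.card_univ, Fintype.card_fin, nsmul_eq_mul] at hsum
    have herr := err_le hL₁ hL₂ hL₃ hlam2
    have hB1 := le_iterBound_mul_smoothingSq hd hL₁ hL₂ hL₃ hε ‖x₀ - xF‖
    rw [← hlam2] at hB1
    have hB2 : 64 * ((d : ℝ) + 6) * L₁ * ‖x₀ - xF‖ ^ 2 ≤ T * lam ^ 2 * ε := by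
      rw [← div_le_iff₀ hε]
      exact hB1.trans (by gcongr)
    have hηR : ‖x₀ - xF‖ ^ 2
        = stepsize d L₁ * (64 * ((d : ℝ) + 6) * L₁ * ‖x₀ - xF‖ ^ 2) / 8 := by
      rw [stepsize]
      field_simp
      norm_num
    have h1 : stepsize d L₁ * T * (A + lam ^ 2 / 2 * B - regLoss f lam xF)
        ≤ stepsize d L₁ * T * (lam ^ 2 * ε / 2) := by
      calc _ = stepsize d L₁ * (T * A + lam ^ 2 / 2 * (T * B) - T * regLoss f lam xF) := by ring
        _ ≤ _ := hsum
        _ ≤ stepsize d L₁ * (T * lam ^ 2 * ε) / 8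
            + T * (stepsize d L₁ * (3 / 16 * (lam ^ 2 * ε))) := by
          rw [hηR]
          gcongr
        _ = stepsize d L₁ * T * (5 / 16 * (lam ^ 2 * ε)) := by ring
        _ ≤ stepsize d L₁ * T * (lam ^ 2 * ε / 2) := by
          have : 0 ≤ lam ^ 2 * ε := by positivity
          gcongr
          linarith
    exact le_of_mul_le_mul_left h1 (by positivity)
  have hB0 : 0 ≤ B := integral_nonneg fun ω => trHess_nonneg h.contDiff hc _
  have hAmin : ∀ y ∈ minimizers f, f y ≤ A := fun y hy => by
    have := integral_mono (integrable_const (f y)) if1 (fun ω => hy (x (τ ω) ω))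
    simpa using this
  -- F(x_F) ≤ F(y) and f(y) ≤ A cancel the values of f, and dividing by λ²/2 leaves the traces.
  have htr : ∀ y ∈ minimizers f, B - ε ≤ trHess f y := fun y hy => by
    have h1 := hF y
    have h2 := hAmin y hy
    have h3 : lam ^ 2 / 2 * (B - ε) ≤ lam ^ 2 / 2 * trHess f y := by
      rw [show regLoss f lam y = f y + lam ^ 2 / 2 * trHess f y from rfl] at h1
      linarith
    exact le_of_mul_le_mul_left h3 (by positivity)
  refine ⟨if1, it1, ?_, ?_⟩
  · obtain ⟨y, hy⟩ := hne
    have hinf : ⨅ z, f z = f y :=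
      le_antisymm (ciInf_le ⟨f y, by rintro _ ⟨z, rfl⟩; exact hy z⟩ y) (le_ciInf hy)
    rw [hinf, integral_sub if1 (integrable_const _)]
    have h1 := hF y
    rw [show regLoss f lam y = f y + lam ^ 2 / 2 * trHess f y from rfl] at h1
    have h2 : trHess f y ≤ L₁ * ((d : ℝ) + 6) := by
      have := h.trHess_le hL₁.le y
      linarith
    have h4 := smoothingSq_le_fourth d L₁ L₂ L₃ ε
    rw [← hlam2] at h4
    have h5 : lam ^ 2 / 2 * trHess f y ≤ lam ^ 2 / 2 * (L₁ * ((d : ℝ) + 6)) := by gcongr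
    have h6 : 0 ≤ lam ^ 2 / 2 * B := by positivity
    have h7 : ∫ _ : Ω, f y ∂P = f y := by simp
    rw [h7]
    -- The trace at the output is discarded as nonnegative, the trace at y is at most L₁(d+6), and
    -- λ² is bounded by its fourth entry.
    calc A - f y ≤ lam ^ 2 * ((ε + L₁ * ((d : ℝ) + 6)) / 2) := by linarith
      _ ≤ 3 * L₁ * ε / (L₂ ^ 2 * ((d : ℝ) + 6) ^ 3) * ((ε + L₁ * ((d : ℝ) + 6)) / 2) := by gcongr
      _ = _ := by
        field_simp
        ring
  · rw [integral_sub it1 (integrable_const _)]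
    have : Nonempty (minimizers f) := hne.to_subtype
    have h1 : B - ε ≤ minTrHess f := le_ciInf fun y => htr y y.2
    have h2 : ∫ _ : Ω, minTrHess f ∂P = minTrHess f := by simp
    rw [h2]
    linarith

lemma smoothing_le (hd : 1 ≤ d) (hL₁ : 0 < L₁) (hL₂ : 0 < L₂) {ε lam : ℝ} (hε : 0 < ε)
    (hlam : 0 < lam) (hlam2 : lam ^ 2 = smoothingSq d L₁ L₂ L₃ ε) :
    lam ≤ √(3 * L₁ / L₂ ^ 2) * (ε ^ (1 / 2 : ℝ) / (d : ℝ) ^ (3 / 2 : ℝ)) := by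
  have hdp : (0 : ℝ) < d := by exact_mod_cast hd
  refine (sq_le_sq₀ hlam.le (by positivity)).1 ?_
  have h4 := smoothingSq_le_fourth d L₁ L₂ L₃ ε
  rw [← hlam2] at h4
  have e1 : (ε ^ (1 / 2 : ℝ)) ^ 2 = ε := by
    rw [← Real.rpow_natCast, ← Real.rpow_mul hε.le]; norm_num
  have e2 : ((d : ℝ) ^ (3 / 2 : ℝ)) ^ 2 = (d : ℝ) ^ 3 := by
    rw [← Real.rpow_natCast, ← Real.rpow_mul hdp.le, ← Real.rpow_natCast]; norm_num
  rw [mul_pow, div_pow, e1, e2, Real.sq_sqrt (by positivity)]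
  calc lam ^ 2 ≤ _ := h4
    _ ≤ 3 * L₁ * ε / (L₂ ^ 2 * (d : ℝ) ^ 3) := by
      gcongr
      linarith
    _ = _ := by field_simp

/-- Each entry of the maximum is at most one summand of the constant times d³/ε, and the prefactor
supplies the remaining d/ε. The bound ε ≤ ε₀ is needed for the first two entries, which grow more
slowly than 1/ε; 121, 25 and 343 come from d + 10 ≤ 11d, d + 4 ≤ 5d, d + 6 ≤ 7d. -/
lemma iterBound_le (hd : 1 ≤ d) (hL₁ : 0 < L₁) (hL₂ : 0 < L₂) (hL₃ : 0 < L₃) {ε ε₀ : ℝ}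
    (hε : 0 < ε) (hε₀ : ε ≤ ε₀) (R : ℝ) :
    iterBound d L₁ L₂ L₃ ε R ≤ 448 * L₁ * (L₃ * ε₀ / (√2 * L₁)
        + 121 * L₃ * √ε₀ / (12 * √L₁) + 100 * L₃ / 3 + 343 * L₂ ^ 2 / (3 * L₁))
      * (R ^ 2 * ((d : ℝ) ^ 4 / ε ^ 2)) := by
  have hd1 : (1 : ℝ) ≤ d := by exact_mod_cast hd
  have hdp : (0 : ℝ) < d := by linarith
  have hε₀p : 0 < ε₀ := hε.trans_le hε₀
  have hs : √(L₁ * ε) = √L₁ * √ε := Real.sqrt_mul hL₁.le ε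
  have hse : √ε * √ε = ε := Real.mul_self_sqrt hε.le
  have hsp : 0 < √ε := Real.sqrt_pos.2 hε
  have hss : √ε ≤ √ε₀ := Real.sqrt_le_sqrt hε₀
  have hd23 : (d : ℝ) ^ 2 ≤ (d : ℝ) ^ 3 := pow_le_pow_right₀ hd1 (by norm_num)
  set M := L₃ * ε₀ / (√2 * L₁) + 121 * L₃ * √ε₀ / (12 * √L₁) + 100 * L₃ / 3
    + 343 * L₂ ^ 2 / (3 * L₁) with hM
  have t1 : 0 ≤ L₃ * ε₀ / (√2 * L₁) := by positivity
  have t2 : 0 ≤ 121 * L₃ * √ε₀ / (12 * √L₁) := by positivity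
  have t3 : 0 ≤ 100 * L₃ / 3 := by positivity
  have t4 : 0 ≤ 343 * L₂ ^ 2 / (3 * L₁) := by positivity
  have c1 : (d : ℝ) ^ (3 / 2 : ℝ) * L₃ / (√2 * L₁) ≤ M * ((d : ℝ) ^ 3 / ε) := by
    have h1 : (d : ℝ) ^ (3 / 2 : ℝ) ≤ (d : ℝ) ^ 3 := by
      rw [← Real.rpow_natCast]
      exact Real.rpow_le_rpow_of_exponent_le hd1 (by norm_num)
    calc _ ≤ (d : ℝ) ^ 3 * L₃ / (√2 * L₁) := by gcongr
      _ = (L₃ * ε / (√2 * L₁)) * ((d : ℝ) ^ 3 / ε) := by field_simp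
      _ ≤ (L₃ * ε₀ / (√2 * L₁)) * ((d : ℝ) ^ 3 / ε) := by gcongr
      _ ≤ _ := by gcongr; linarith
  have c2 : L₃ * ((d : ℝ) + 10) ^ 2 / (12 * √(L₁ * ε)) ≤ M * ((d : ℝ) ^ 3 / ε) := by
    have h1 : ((d : ℝ) + 10) ^ 2 ≤ 121 * (d : ℝ) ^ 3 := by nlinarith
    calc _ ≤ L₃ * (121 * (d : ℝ) ^ 3) / (12 * (√L₁ * √ε)) := by rw [hs]; gcongr
      _ = (121 * L₃ * √ε / (12 * √L₁)) * ((d : ℝ) ^ 3 / (√ε * √ε)) := by field_simp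
      _ ≤ (121 * L₃ * √ε₀ / (12 * √L₁)) * ((d : ℝ) ^ 3 / ε) := by rw [hse]; gcongr
      _ ≤ _ := by gcongr; linarith
  have c3 : 4 * L₃ * ((d : ℝ) + 4) ^ 2 / (3 * ε) ≤ M * ((d : ℝ) ^ 3 / ε) := by
    have h1 : ((d : ℝ) + 4) ^ 2 ≤ 25 * (d : ℝ) ^ 3 := by nlinarith
    calc _ ≤ 4 * L₃ * (25 * (d : ℝ) ^ 3) / (3 * ε) := by gcongr
      _ = (100 * L₃ / 3) * ((d : ℝ) ^ 3 / ε) := by field_simp; norm_num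
      _ ≤ _ := by gcongr; linarith
  have c4 : L₂ ^ 2 * ((d : ℝ) + 6) ^ 3 / (3 * L₁ * ε) ≤ M * ((d : ℝ) ^ 3 / ε) := by
    have h1 : ((d : ℝ) + 6) ^ 3 ≤ (7 * (d : ℝ)) ^ 3 := by gcongr; linarith
    calc _ ≤ L₂ ^ 2 * (7 * (d : ℝ)) ^ 3 / (3 * L₁ * ε) := by gcongr
      _ = (343 * L₂ ^ 2 / (3 * L₁)) * ((d : ℝ) ^ 3 / ε) := by field_simp; norm_num
      _ ≤ _ := by gcongr; linarith
  rw [iterBound]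
  calc _ ≤ 64 * (7 * (d : ℝ)) * L₁ * R ^ 2 / ε * (M * ((d : ℝ) ^ 3 / ε)) := by
        gcongr
        · linarith
        · exact max_le (max_le c1 c2) (max_le c3 c4)
    _ = _ := by
      field_simp
      ring

lemma valueBound_le (hd : 1 ≤ d) (hL₁ : 0 < L₁) (hL₂ : 0 < L₂) {ε ε₀ : ℝ} (hε : 0 < ε)
    (hε₀ : ε ≤ ε₀) :
    3 * L₁ ^ 2 * ε / (2 * L₂ ^ 2 * ((d : ℝ) + 6) ^ 2) * (1 + ε / (L₁ * ((d : ℝ) + 6)))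
      ≤ 3 * L₁ ^ 2 / (2 * L₂ ^ 2) * (1 + ε₀ / L₁) * (ε / (d : ℝ) ^ 2) := by
  have hd1 : (1 : ℝ) ≤ d := by exact_mod_cast hd
  have hdp : (0 : ℝ) < d := by linarith
  have hε₀p : 0 < ε₀ := hε.trans_le hε₀
  calc _ ≤ 3 * L₁ ^ 2 * ε / (2 * L₂ ^ 2 * (d : ℝ) ^ 2) * (1 + ε₀ / L₁) := by
        gcongr
        · linarith
        · exact le_mul_of_one_le_right hL₁.le (by linarith)
    _ = _ := by field_simp

lemma IsApproxFlatMinInExpectation.mono {Ω : Type*} [MeasurableSpace Ω] {P : Measure Ω}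
    {X : Ω → E d} {a b ε : ℝ} (h : IsApproxFlatMinInExpectation P f X a ε) (hab : a ≤ b) :
    IsApproxFlatMinInExpectation P f X b ε :=
  ⟨h.integrable_value, h.integrable_trace, h.value_le.trans hab, h.trace_le⟩

end

end ZOFlat

theorem corollary1 (L₁ L₂ L₃ : ℝ) (hL₁ : 0 < L₁) (hL₂ : 0 < L₂) (hL₃ : 0 < L₃) :
    -- explicit guarantee
    (∀ (d : ℕ) (f : ZOFlat.E d → ℝ) (ε lam : ℝ) (x₀ xF : ZOFlat.E d) (T : ℕ),
      1 ≤ d → ZOFlat.Smoothness f L₁ L₂ L₃ → ConvexOn ℝ Set.univ f →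
      (ZOFlat.minimizers f).Nonempty →
      0 < ε → 0 < lam → lam ^ 2 = ZOFlat.smoothingSq d L₁ L₂ L₃ ε →
      xF ∈ ZOFlat.minimizers (ZOFlat.regLoss f lam) →
      1 ≤ T → ZOFlat.iterBound d L₁ L₂ L₃ ε ‖x₀ - xF‖ ≤ (T : ℝ) →
      ∀ (Ω : Type*) [MeasurableSpace Ω] (P : Measure Ω) [IsProbabilityMeasure P]
        (u : Fin T → Ω → ZOFlat.E d) (x : ℕ → Ω → ZOFlat.E d) (τ : Ω → Fin T),
        ZOFlat.IsRun P f (ZOFlat.stepsize d L₁) lam x₀ T u x τ →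
        ZOFlat.IsApproxFlatMinInExpectation P f (fun ω => x (τ ω) ω)
          (3 * L₁ ^ 2 * ε / (2 * L₂ ^ 2 * ((d : ℝ) + 6) ^ 2) * (1 + ε / (L₁ * ((d : ℝ) + 6))))
          ε) ∧
    -- orders in `d` and `ε`, with constants that depend only on `L₁, L₂, L₃, ε₀`
    (∀ ε₀ : ℝ, 0 < ε₀ → ∃ C : ℝ, 0 < C ∧
      ∀ (d : ℕ) (f : ZOFlat.E d → ℝ) (ε lam : ℝ) (x₀ xF : ZOFlat.E d),
      1 ≤ d → ZOFlat.Smoothness f L₁ L₂ L₃ → ConvexOn ℝ Set.univ f →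
      (ZOFlat.minimizers f).Nonempty →
      0 < ε → ε ≤ ε₀ → 0 < lam → lam ^ 2 = ZOFlat.smoothingSq d L₁ L₂ L₃ ε →
      xF ∈ ZOFlat.minimizers (ZOFlat.regLoss f lam) →
      lam ≤ C * (ε ^ (1 / 2 : ℝ) / (d : ℝ) ^ (3 / 2 : ℝ)) ∧
      ∃ T : ℕ, 1 ≤ T ∧ ZOFlat.iterBound d L₁ L₂ L₃ ε ‖x₀ - xF‖ ≤ (T : ℝ) ∧
        (T : ℝ) ≤ C * (1 + ‖x₀ - xF‖ ^ 2) * ((d : ℝ) ^ 4 / ε ^ 2) ∧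
        ∀ (Ω : Type*) [MeasurableSpace Ω] (P : Measure Ω) [IsProbabilityMeasure P]
          (u : Fin T → Ω → ZOFlat.E d) (x : ℕ → Ω → ZOFlat.E d) (τ : Ω → Fin T),
          ZOFlat.IsRun P f (ZOFlat.stepsize d L₁) lam x₀ T u x τ →
          ZOFlat.IsApproxFlatMinInExpectation P f (fun ω => x (τ ω) ω)
            (C * (ε / (d : ℝ) ^ 2)) ε) := by
  refine ⟨fun d f ε lam x₀ xF T hd h hc hne hε hlam hlam2 hF hT1 hT Ω _ P _ u x τ hr =>
    hr.isApproxFlatMinInExpectation hL₁ hL₂ hL₃ hd h hc hne hε hlam hlam2 hF hT1 hT, ?_⟩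
  intro ε₀ hε₀
  set C₁ := √(3 * L₁ / L₂ ^ 2) with hC₁
  set C₂ := 448 * L₁ * (L₃ * ε₀ / (√2 * L₁) + 121 * L₃ * √ε₀ / (12 * √L₁) + 100 * L₃ / 3
    + 343 * L₂ ^ 2 / (3 * L₁)) with hC₂
  set C₃ := 3 * L₁ ^ 2 / (2 * L₂ ^ 2) * (1 + ε₀ / L₁) with hC₃
  have p1 : 0 < C₁ := by positivity
  have p2 : 0 < C₂ := by positivity
  have p3 : 0 < C₃ := by positivity
  -- One constant dominates those for λ, T and the value; 2ε₀² pays for rounding T up to an integer.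
  refine ⟨C₁ + (C₂ + 2 * ε₀ ^ 2) + C₃, by positivity, ?_⟩
  intro d f ε lam x₀ xF hd h hc hne hε hεε₀ hlam hlam2 hF
  have hd1 : (1 : ℝ) ≤ d := by exact_mod_cast hd
  have hdp : (0 : ℝ) < d := by linarith
  set R := ‖x₀ - xF‖ with hR
  refine ⟨(ZOFlat.smoothing_le hd hL₁ hL₂ hε hlam hlam2).trans ?_,
    -- The extra 1 keeps T positive when x₀ = x_F, where the bound is 0.
    ⌈ZOFlat.iterBound d L₁ L₂ L₃ ε R⌉₊ + 1, by omega, ?_, ?_, ?_⟩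
  · gcongr
    nlinarith [sq_nonneg ε₀]
  · push_cast
    linarith [Nat.le_ceil (ZOFlat.iterBound d L₁ L₂ L₃ ε R)]
  · have hB := ZOFlat.iterBound_le hd hL₁ hL₂ hL₃ hε hεε₀ R
    rw [← hC₂] at hB
    have hB0 : 0 ≤ ZOFlat.iterBound d L₁ L₂ L₃ ε R := by
      unfold ZOFlat.iterBound
      positivity
    have hceil := (Nat.ceil_lt_add_one hB0).le
    set Q := (d : ℝ) ^ 4 / ε ^ 2 with hQ
    have hQ0 : 0 < Q := by positivity
    -- Since T ≤ B + 2, the additive 2 is absorbed by 2ε₀²Q, using ε ≤ ε₀ and d ≥ 1.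
    have hQ1 : 1 ≤ ε₀ ^ 2 * Q := by
      rw [hQ, ← mul_div_assoc, one_le_div (by positivity)]
      calc ε ^ 2 ≤ ε₀ ^ 2 := by gcongr
        _ ≤ ε₀ ^ 2 * (d : ℝ) ^ 4 := le_mul_of_one_le_right (by positivity) (one_le_pow₀ hd1)
    push_cast
    have q1 : 0 ≤ (C₁ + C₃) * (1 + R ^ 2) * Q := by positivity
    have q2 : 0 ≤ C₂ * Q := by positivity
    have q3 : 0 ≤ ε₀ ^ 2 * Q * R ^ 2 := by positivity
    nlinarith
  · intro Ω _ P _ u x τ hr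
    refine (hr.isApproxFlatMinInExpectation hL₁ hL₂ hL₃ hd h hc hne hε hlam hlam2 hF (by omega)
      ?_).mono ((ZOFlat.valueBound_le hd hL₁ hL₂ hε hεε₀).trans ?_)
    · push_cast
      linarith [Nat.le_ceil (ZOFlat.iterBound d L₁ L₂ L₃ ε R)]
    · rw [← hC₃]
      gcongr
      nlinarith [sq_nonneg ε₀]
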